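/- Let $e_1<e_2<e_3<e_4$ be real numbers, let $D\ge 0$ be an integer and $\hbar>0$. For $\mu=(\mu_1,\dots,\mu_4)\in\{0,1\}^4$ put $|\mu|=\sum_i\mu_i$ and $\gamma_i=\tfrac12+\mu_i$. For $d\ge 0$ let $HS^\mu_d$ be the set of monic real polynomials $S$ of degree $d$ (Heine–Stieltjes polynomials) that solve, for some real $c_0,c_1,c_2$, the generalised Lamé equation $$S''+\Big(\sum_{j=1}^4\frac{\gamma_j}{z-e_j}\Big)S'+\frac{c_0z^2+c_1z+c_2}{4\prod_{j=1}^4(z-e_j)}\,S=0 .$$ The eigenstates of degree $D$ in the symmetry class $\mu$ are labelled by the $S\in HS^\mu_d$ with $2d+|\mu|=D$ (there are none if no such $d$ exists); the wave function of $S$, with zeros $z_1,\dots,z_d$, is $$\Psi^\mu_S(x)=x_1^{\mu_1}x_2^{\mu_2}x_3^{\mu_3}x_4^{\mu_4}\prod_{k=1}^d\Big(\prod_{i=1}^4(z_k-e_i)\Big)\sum_{i=1}^4\frac{x_i^2}{z_k-e_i}.$$ Then the following hold. 1. Exactly 8 of the 16 classes $\mu$ are admissible, meaning that $|\mu|$ has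 the parity of $E=D(D+2)$; the other classes contain no eigenstate of degree $D$. 2. For all $\mu$ and $d$, $HS^\mu_d$ has exactly $\binom{d+2}{2}$ elements, and each of them has $d$ distinct real zeros, all lying in $(e_1,e_2)\cup(e_2,e_3)\cup(e_3,e_4)$. 3. For every admissible $\mu$ the number of eigenstates of degree $D$ in the class $\mu$ is $\binom{(D+4-|\mu|)/2}{2}$. That is, $\binom{(D+4)/2}{2}$, $\binom{(D+2)/2}{2}$, $\binom{D/2}{2}$ for $|\mu|=0,2,4$ ($E$ even) and $\binom{(D+3)/2}{2}$, $\binom{(D+1)/2}{2}$ for $|\mu|=1,3$ ($E$ odd). 4. Summing over the 8 admissible classes, the total number of eigenstates of degree $D$ is $N=(D+1)^2$. 5. Each $\Psi^\mu_S$ is a homogeneous harmonic polynomial of degree $D$ on $\mathbb R^4$, is odd in $x_i$ if $\mu_i=1$ and even in $x_i$ if $\mu_i=0$, and its restriction to $S^3$ solves $-\hbar^2\Delta_{S^3}\psi=\hbar^2D(D+2)\psi$. If $s=(s_1,s_2,s_3)$ are ellipsoidal coordinates of $x\in S^3$, that is $e_j\le s_j\le e_{j+1}$ for $j=1,2,3$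 and $x_i^2=\prod_{j=1}^3(s_j-e_i)/\prod_{k\ne i}(e_k-e_i)$ for $i=1,\dots,4$, then $\Psi^\mu_S(x)=(-1)^d\,x_1^{\mu_1}x_2^{\mu_2}x_3^{\mu_3}x_4^{\mu_4}\,S(s_1)S(s_2)S(s_3)$. 6. The $(D+1)^2$ wave functions of degree $D$ form a basis of the space of homogeneous harmonic polynomials of degree $D$ on $\mathbb R^4$, whose dimension is thus $(D+1)^2$. Their restrictions to $S^3$ are linearly independent and span the space of all real $C^2$ solutions $\psi$ on $S^3$ of $-\hbar^2\Delta_{S^3}\psi=\hbar^2D(D+2)\psi$, so the ellipsoidal construction yields every eigenfunction. -/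

import Mathlib

open scoped Laplacian

noncomputable section

namespace EllipsoidalS3

/-- Four-dimensional Euclidean space. -/
abbrev E4 : Type := EuclideanSpace ℝ (Fin 4)

/-- The unit sphere `S³` in `ℝ⁴`. -/
abbrev S3 : Set E4 := Metric.sphere (0 : E4) 1

/-! ### The Schrödinger equation on the sphere -/

/-- The extension of `f : S³ → ℝ` to `ℝ⁴ ∖ {0}` that is constant along rays
(with the irrelevant value `0` at the origin). -/
def radialExtension (f : S3 → ℝ) (y : E4) : ℝ :=
  open Classical in
  if h : y = 0 then 0
  else f ⟨‖y‖⁻¹ • y, by simp [norm_smul, norm_ne_zero_iff.mpr h]⟩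

/-- The Laplace-Beltrami operator of the round sphere `S³`: the Euclidean Laplacian of the
extension that is constant along rays, restricted to the sphere. -/
def laplaceBeltrami (f : S3 → ℝ) (x : S3) : ℝ :=
  Δ (radialExtension f) (x : E4)

/-- `f` is a twice continuously differentiable function on the sphere. -/
def IsC2OnSphere (f : S3 → ℝ) : Prop :=
  ContDiffOn ℝ 2 (radialExtension f) {0}ᶜ

/-- `ψ` is a `C²` solution on `S³` of the stationary Schrödinger equation `-ħ² Δ ψ = Ẽ ψ`. -/
def IsSchrodingerSolution (hbar energy : ℝ) (ψ : S3 → ℝ) : Prop :=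
  IsC2OnSphere ψ ∧ ∀ x : S3, -hbar ^ 2 * laplaceBeltrami ψ x = energy * ψ x

/-! ### Harmonic polynomials in four variables -/

/-- The Laplacian `∑ ∂ᵢ²` on polynomials in `x₁, …, x₄`. -/
def polyLaplacian : MvPolynomial (Fin 4) ℝ →ₗ[ℝ] MvPolynomial (Fin 4) ℝ :=
  ∑ i : Fin 4,
    (MvPolynomial.pderiv (R := ℝ) i).toLinearMap ∘ₗ (MvPolynomial.pderiv (R := ℝ) i).toLinearMap

/-- The space of homogeneous harmonic polynomials of degree `D` in four variables. -/
def harmonicPolys (D : ℕ) : Submodule ℝ (MvPolynomial (Fin 4) ℝ) :=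
  MvPolynomial.homogeneousSubmodule (Fin 4) ℝ D ⊓ LinearMap.ker polyLaplacian

/-- The restriction of a polynomial to the sphere. -/
def restrictToSphere (p : MvPolynomial (Fin 4) ℝ) (x : S3) : ℝ :=
  MvPolynomial.eval (fun i => (x : E4) i) p

/-! ### Symmetry classes -/

/-- A discrete symmetry class `μ ∈ {0,1}⁴`: `μ i = 1` means odd in `xᵢ`, `μ i = 0` even. -/
abbrev SymClass : Type := Fin 4 → Fin 2

/-- The number of coordinates in which the class is odd. -/
def SymClass.weight (μ : SymClass) : ℕ := ∑ i, (μ i : ℕ)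

/-- The symmetry classes with the same parity as the energy `E = D (D + 2)`. -/
def admissibleClasses (D : ℕ) : Finset SymClass :=
  Finset.univ.filter fun μ => Even μ.weight ↔ Even (D * (D + 2))

/-- The exponent parameters `γ̃`: `3/2` at `e i` if `μ i = 1`, and `1/2` if `μ i = 0`. -/
def gammaParam (μ : SymClass) (i : Fin 4) : ℝ := if μ i = 1 then 3 / 2 else 1 / 2

/-- `p` is odd in `xᵢ` if `μ i = 1` and even in `xᵢ` if `μ i = 0`, for every `i`. -/
def HasSymmetry (μ : SymClass) (p : MvPolynomial (Fin 4) ℝ) : Prop :=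
  ∀ (i : Fin 4) (x : Fin 4 → ℝ),
    MvPolynomial.eval (Function.update x i (-x i)) p
      = (-1) ^ (μ i : ℕ) * MvPolynomial.eval x p

/-! ### The generalised Lamé equation and its polynomial solutions -/

open Polynomial in
/-- The polynomial `w` solves the Fuchsian equation
`w'' + (∑ⱼ γⱼ / (z - eⱼ)) w' + (c₀ z² + c₁ z + c₂) / (4 ∏ⱼ (z - eⱼ)) w = 0`,
written after multiplication by `4 ∏ⱼ (z - eⱼ)`. -/
def SolvesLame (e γ : Fin 4 → ℝ) (c₀ c₁ c₂ : ℝ) (w : ℝ[X]) : Prop :=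
  4 * (∏ j, (X - C (e j))) * derivative (derivative w)
    + 4 * (∑ j, C (γ j) * ∏ k ∈ Finset.univ.erase j, (X - C (e k))) * derivative w
    + (C c₀ * X ^ 2 + C c₁ * X + C c₂) * w = 0

/-- The Heine-Stieltjes polynomials of degree `d`, normalised to be monic: the polynomials of
degree `d` that solve the equation for some values of the spectral parameters. -/
def heineStieltjes (e γ : Fin 4 → ℝ) (d : ℕ) : Set (Polynomial ℝ) :=
  {S | S.Monic ∧ S.natDegree = d ∧ ∃ c₀ c₁ c₂ : ℝ, SolvesLame e γ c₀ c₁ c₂ S}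

/-! ### Ellipsoidal coordinates and the eigenstates -/

/-- `s = (s₁, s₂, s₃)` are the ellipsoidal coordinates of the point `x` of `S³`. -/
def IsEllipsoidalCoord (e : Fin 4 → ℝ) (x : Fin 4 → ℝ) (s : Fin 3 → ℝ) : Prop :=
  (∀ j : Fin 3, e j.castSucc ≤ s j ∧ s j ≤ e j.succ) ∧
    ∀ i : Fin 4, x i ^ 2 = (∏ j, (s j - e i)) / ∏ k ∈ Finset.univ.erase i, (e k - e i)

/-- The quadratic form `(∏ᵢ (z - eᵢ)) ∑ᵢ xᵢ² / (z - eᵢ)`, with the denominators cancelled. -/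
def quadricForm (e : Fin 4 → ℝ) (z : ℝ) : MvPolynomial (Fin 4) ℝ :=
  ∑ i, MvPolynomial.C (∏ k ∈ Finset.univ.erase i, (z - e k)) * MvPolynomial.X i ^ 2

/-- The wave function of class `μ` in Cartesian coordinates attached to a polynomial `S`:
`x₁^μ₁ x₂^μ₂ x₃^μ₃ x₄^μ₄` times the product over the zeros `z` of `S` of the quadratic forms
`(∏ᵢ (z - eᵢ)) ∑ᵢ xᵢ² / (z - eᵢ)`. -/
def waveFunction (e : Fin 4 → ℝ) (μ : SymClass) (S : Polynomial ℝ) : MvPolynomial (Fin 4) ℝ :=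
  (∏ i, MvPolynomial.X i ^ (μ i : ℕ)) * (S.roots.map (quadricForm e)).prod

/-- The eigenstates of degree `D` in the class `μ`, labelled by their Heine-Stieltjes
polynomials, whose degree `d` satisfies `2 d + ∑ᵢ μᵢ = D`. -/
def classStates (e : Fin 4 → ℝ) (D : ℕ) (μ : SymClass) : Set (Polynomial ℝ) :=
  {S | ∃ d : ℕ, 2 * d + μ.weight = D ∧ S ∈ heineStieltjes e (gammaParam μ) d}

/-- All eigenstates of degree `D`, labelled by symmetry class and Heine-Stieltjes polynomial. -/
def eigenstates (e : Fin 4 → ℝ) (D : ℕ) : Set (SymClass × Polynomial ℝ) :=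
  {st | st.2 ∈ classStates e D st.1}

end EllipsoidalS3

end

/-!
The count of Heine-Stieltjes polynomials comes from two bounds that meet.

*Upper bound.* If `S` and `T` solve Lamé equations with the same exponents and have the same degree,
their leading spectral parameters agree, and integrating `(lameOp S) T - (lameOp T) S` against the
Lamé weight over a gap between consecutive nodes gives zero (`gapMoment_lameOp_symm`). Two gaps and
the two remaining spectral parameters make a singular `2 × 2` system, so `S(s) S(t)` and
`T(s) T(t)` are orthogonal for the weight `(t - s) w(s) w(t)`, of constant sign on the product of
the first two gaps (`gapPairing_eq_zero`, `gapPairing_self_neg`). The symmetric matrices of products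
of coefficients are therefore linearly independent, and their space has dimension
`(d + 2).choose 2`.

*Lower bound.* For each distribution of `d` zeros over the three gaps, a maximum of the Stieltjes
product of distances is an equilibrium, and its points are the zeros of a Heine-Stieltjes polynomial
(`exists_heineStieltjes_of_distribution`). There are `(d + 2).choose 2` distributions, so these are
all the Heine-Stieltjes polynomials, and their zeros are real, simple and in the gaps
(`heineStieltjes_count`). Summing over the symmetry classes gives `(D + 1) ^ 2` states.

The equilibrium equations are precisely the condition for a product of confocal quadrics, times the
monomial of the class, to be harmonic (`polyLaplacian_niven`), and Lagrange interpolation factorises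
a confocal quadric in ellipsoidal coordinates (`eval_quadricForm_ellipsoidal`). The wave functions
are independent on the sphere: averaging over sign changes separates the classes, and within a class
the independence of the `S(s) S(t)` applies (`restrict_waveFunction_linearIndepOn`). A harmonic
polynomial is determined by its coefficients of degree at most one in the last variable, so the
harmonic polynomials of degree `D` have dimension at most `(D + 1) ^ 2` and the wave functions form
a basis (`span_waveFunction`).

Finally, an arbitrary `C²` eigenfunction on the sphere is a spherical harmonic
(`mem_sphericalHarmonics_of_eigenfunction`). Integrals over the sphere are replaced by integrals
over an annulus of functions extended constantly along rays. Green's identity there shows that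
eigenfunctions for different eigenvalues are orthogonal, so an eigenfunction minus its projection to
the harmonics of degree `D` is orthogonal to all harmonics, hence to all polynomials, and vanishes
by the Stone-Weierstrass theorem.
-/

/-! ### Moment functionals of the Lamé weight -/

namespace EllipsoidalS3

open Polynomial MeasureTheory Set

/-- The weight `∏ₖ |z - eₖ| ^ αₖ`. -/
noncomputable def absWeight (e α : Fin 4 → ℝ) (z : ℝ) : ℝ := ∏ k, |z - e k| ^ α k

lemma ne_node_of_mem_Ioo {e : Fin 4 → ℝ} (he : StrictMono e) {j : Fin 3} {z : ℝ}
    (hz : z ∈ Ioo (e j.castSucc) (e j.succ)) (k : Fin 4) : z ≠ e k := by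
  rintro rfl
  have h1 := he.lt_iff_lt.1 hz.1
  have h2 := he.lt_iff_lt.1 hz.2
  exact absurd (Fin.castSucc_lt_iff_succ_le.1 h1) (not_le.2 h2)

lemma node_lt (e : Fin 4 → ℝ) (he : StrictMono e) (j : Fin 3) : e j.castSucc < e j.succ :=
  he Fin.castSucc_lt_succ

/-- On the `j`-th gap, the sign of `z - eₖ` depends on `k` only. -/
lemma abs_sub_node {e : Fin 4 → ℝ} (he : StrictMono e) {j : Fin 3} {z : ℝ}
    (hz : z ∈ Ioo (e j.castSucc) (e j.succ)) (k : Fin 4) :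
    |z - e k| = (if k ≤ j.castSucc then 1 else -1) * (z - e k) := by
  split_ifs with h
  · rw [one_mul, abs_of_pos]
    have := he.monotone h
    linarith [hz.1]
  · have h' : j.succ ≤ k := Fin.castSucc_lt_iff_succ_le.1 (not_le.1 h)
    rw [abs_of_neg, neg_one_mul]
    have := he.monotone h'
    linarith [hz.2]

lemma intervalIntegrable_abs_sub_rpow {α : ℝ} (hα : -1 < α) (c a b : ℝ) :
    IntervalIntegrable (fun z => |z - c| ^ α) volume a b := by
  have h0 : ∀ t : ℝ, 0 ≤ t → IntervalIntegrable (fun z : ℝ => |z| ^ α) volume 0 t := by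
    intro t ht
    refine (intervalIntegral.intervalIntegrable_rpow' (a := 0) (b := t) hα).congr ?_
    intro z hz
    rw [uIoc_of_le ht] at hz
    simp only [abs_of_pos hz.1]
  have h1 : ∀ t : ℝ, IntervalIntegrable (fun z : ℝ => |z| ^ α) volume 0 t := by
    intro t
    rcases le_total 0 t with ht | ht
    · exact h0 t ht
    · have := (IntervalIntegrable.iff_comp_neg (by finiteness)).1 (h0 (-t) (by linarith))
      simpa using this
  have h2 := ((h1 (a - c)).symm.trans (h1 (b - c))).comp_sub_right c (by finiteness)
  simpa using h2

lemma continuousOn_abs_sub_rpow {α c : ℝ} {s : Set ℝ} (hc : c ∉ s) :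
    ContinuousOn (fun z => |z - c| ^ α) s := by
  refine ContinuousOn.rpow_const (by fun_prop) fun z hz => Or.inl ?_
  rw [abs_ne_zero, sub_ne_zero]
  rintro rfl
  exact hc hz

/-- Near a single node the weight is integrable, the other factors being continuous. -/
lemma intervalIntegrable_absWeight_of_single_node {e α : Fin 4 → ℝ} (hα : ∀ k, -1 < α k) {a b : ℝ}
    (i : Fin 4) (h : ∀ k, k ≠ i → e k ∉ uIcc a b) :
    IntervalIntegrable (absWeight e α) volume a b := by
  have h1 : absWeight e α = fun z => |z - e i| ^ α i *
      ∏ k ∈ Finset.univ.erase i, |z - e k| ^ α k := by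
    funext z
    rw [absWeight, Finset.mul_prod_erase _ (fun k => |z - e k| ^ α k) (Finset.mem_univ i)]
  rw [h1]
  refine (intervalIntegrable_abs_sub_rpow (hα i) _ _ _).mul_continuousOn ?_
  refine continuousOn_finsetProd _ fun k hk => ?_
  exact continuousOn_abs_sub_rpow (h k (Finset.ne_of_mem_erase hk))

lemma intervalIntegrable_absWeight {e α : Fin 4 → ℝ} (he : StrictMono e) (hα : ∀ k, -1 < α k)
    (j : Fin 3) : IntervalIntegrable (absWeight e α) volume (e j.castSucc) (e j.succ) := by
  have hj := node_lt e he j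
  -- each half of the gap contains one node, its endpoint
  refine (intervalIntegrable_absWeight_of_single_node (b := (e j.castSucc + e j.succ) / 2) hα
    j.castSucc fun k hk hk' => ?_).trans
    (intervalIntegrable_absWeight_of_single_node hα j.succ fun k hk hk' => ?_)
  · rw [uIcc_of_le (by linarith)] at hk'
    exact ne_node_of_mem_Ioo he
      ⟨lt_of_le_of_ne hk'.1 fun h => hk (he.injective h.symm), by linarith [hk'.2]⟩ k rfl
  · rw [uIcc_of_le (by linarith)] at hk'
    exact ne_node_of_mem_Ioo he
      ⟨by linarith [hk'.1], lt_of_le_of_ne hk'.2 fun h => hk (he.injective h)⟩ k rfl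

lemma intervalIntegrable_eval_mul_absWeight {e α : Fin 4 → ℝ} (he : StrictMono e)
    (hα : ∀ k, -1 < α k) (j : Fin 3) (p : ℝ[X]) :
    IntervalIntegrable (fun z => p.eval z * absWeight e α z) volume (e j.castSucc) (e j.succ) :=
  (intervalIntegrable_absWeight he hα j).continuousOn_mul p.continuous.continuousOn

/-- The moment functional `p ↦ ∫ p(z) ∏ₖ |z - eₖ| ^ (γₖ - 1) dz` over the gap
`(e j, e (j + 1))`. -/
noncomputable def gapMoment (e γ : Fin 4 → ℝ) (j : Fin 3) (p : ℝ[X]) : ℝ :=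
  ∫ z in e j.castSucc..e j.succ, p.eval z * absWeight e (fun k => γ k - 1) z

lemma gapMoment_add {e γ : Fin 4 → ℝ} (he : StrictMono e) (hγ : ∀ k, 0 < γ k)
    (j : Fin 3) (p q : ℝ[X]) :
    gapMoment e γ j (p + q) = gapMoment e γ j p + gapMoment e γ j q := by
  have hα : ∀ k, -1 < γ k - 1 := fun k => by linarith [hγ k]
  rw [gapMoment, gapMoment, gapMoment, ← intervalIntegral.integral_add
    (intervalIntegrable_eval_mul_absWeight he hα j p)
    (intervalIntegrable_eval_mul_absWeight he hα j q)]
  simp [add_mul]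

/-- The moment functional as a linear map. -/
noncomputable def gapMomentₗ {e γ : Fin 4 → ℝ} (he : StrictMono e) (hγ : ∀ k, 0 < γ k)
    (j : Fin 3) : ℝ[X] →ₗ[ℝ] ℝ where
  toFun := gapMoment e γ j
  map_add' := gapMoment_add he hγ j
  map_smul' c p := by
    simp [gapMoment, mul_assoc]

lemma gapMoment_pos {e γ : Fin 4 → ℝ} (he : StrictMono e) (hγ : ∀ k, 0 < γ k)
    (j : Fin 3) {p : ℝ[X]} (hp : p ≠ 0)
    (hpos : ∀ z ∈ Ioo (e j.castSucc) (e j.succ), 0 ≤ p.eval z) : 0 < gapMoment e γ j p := by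
  have hα : ∀ k, -1 < γ k - 1 := fun k => by linarith [hγ k]
  have hj := node_lt e he j
  have hw : ∀ z ∈ Ioo (e j.castSucc) (e j.succ), 0 < absWeight e (fun k => γ k - 1) z := by
    intro z hz
    refine Finset.prod_pos fun k _ => Real.rpow_pos_of_pos ?_ _
    exact abs_pos.2 (sub_ne_zero.2 (ne_node_of_mem_Ioo he hz k))
  rw [gapMoment, intervalIntegral.integral_pos_iff_support_of_nonneg_ae' ?_
    (intervalIntegrable_eval_mul_absWeight he hα j p)]
  · refine ⟨hj, ?_⟩
    have h1 : Ioo (e j.castSucc) (e j.succ) \ {z | p.IsRoot z} ⊆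
        Function.support (fun z => p.eval z * absWeight e (fun k => γ k - 1) z) ∩
          Ioc (e j.castSucc) (e j.succ) := by
      rintro z ⟨hz, hz'⟩
      exact ⟨mul_ne_zero hz' (hw z hz).ne', hz.1, hz.2.le⟩
    refine lt_of_lt_of_le ?_ (measure_mono h1)
    rw [measure_sdiff_null ((Polynomial.finite_setOfPred_isRoot hp).measure_zero _)]
    simp [hj]
  · rw [uIoc_of_le hj.le]
    rw [← Measure.restrict_congr_set Ioo_ae_eq_Ioc]
    exact ae_restrict_of_forall_mem measurableSet_Ioo fun z hz =>
      mul_nonneg (hpos z hz) (hw z hz).le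

/-- The differential part `4 ∏ⱼ (z - eⱼ) w'' + 4 (∑ⱼ γⱼ ∏ₖ≠ⱼ (z - eₖ)) w'` of the generalised
Lamé equation. -/
noncomputable def lameOp (e γ : Fin 4 → ℝ) (w : ℝ[X]) : ℝ[X] :=
  4 * (∏ j, (X - C (e j))) * derivative (derivative w)
    + 4 * (∑ j, C (γ j) * ∏ k ∈ Finset.univ.erase j, (X - C (e k))) * derivative w

lemma hasDerivAt_abs_sub_rpow (a : ℝ) {c z : ℝ} (hz : z ≠ c) :
    HasDerivAt (fun z => |z - c| ^ a) (a / (z - c) * |z - c| ^ a) z := by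
  have h0 : z - c ≠ 0 := sub_ne_zero.2 hz
  have h1 := ((hasDerivAt_abs h0).comp z ((hasDerivAt_id z).sub_const c)).rpow_const
    (p := a) (Or.inl (by simpa using h0))
  refine h1.congr_deriv ?_
  have h2 : |z - c| ≠ 0 := abs_ne_zero.2 h0
  simp only [Function.comp, id, Real.rpow_sub_one h2]
  rcases lt_or_gt_of_ne h0 with h | h
  · simp [h, abs_of_neg h]
    field_simp
    ring
  · simp [h, abs_of_pos h]
    field_simp

lemma hasDerivAt_absWeight {e : Fin 4 → ℝ} (α : Fin 4 → ℝ) {z : ℝ} (hz : ∀ k, z ≠ e k) :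
    HasDerivAt (absWeight e α) ((∑ k, α k / (z - e k)) * absWeight e α z) z := by
  have h := HasDerivAt.fun_finsetProd (u := Finset.univ)
    fun k _ => hasDerivAt_abs_sub_rpow (α k) (hz k)
  refine h.congr_deriv ?_
  rw [Finset.sum_mul]
  refine Finset.sum_congr rfl fun k hk => ?_
  rw [absWeight, ← Finset.mul_prod_erase _ (fun k => |z - e k| ^ α k) hk, smul_eq_mul]
  ring

/-- The Lamé operator is symmetric for the moment functionals: multiplied by the weight,
`(lameOp S) T - (lameOp T) S` is the derivative of a multiple of `∏ₖ |z - eₖ| ^ γₖ (S' T - T' S)`,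
which vanishes at both ends of the gap. -/
lemma gapMoment_lameOp_symm {e γ : Fin 4 → ℝ} (he : StrictMono e) (hγ : ∀ k, 0 < γ k)
    (j : Fin 3) (S T : ℝ[X]) :
    gapMoment e γ j (lameOp e γ S * T - lameOp e γ T * S) = 0 := by
  have hα : ∀ k, -1 < γ k - 1 := fun k => by linarith [hγ k]
  -- the constant sign of `∏ₖ (z - eₖ)` on the gap
  set σ : ℝ := ∏ k : Fin 4, (if k ≤ j.castSucc then 1 else -1) with hσ
  have hσ2 : σ * σ = 1 := by
    rw [hσ, ← Finset.prod_mul_distrib]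
    refine Finset.prod_eq_one fun k _ => ?_
    split_ifs <;> norm_num
  set W : ℝ[X] := derivative S * T - derivative T * S with hW
  have hdW : derivative W = derivative (derivative S) * T - derivative (derivative T) * S := by
    simp only [hW, derivative_sub, derivative_mul]
    ring
  set F : ℝ → ℝ := fun z => 4 * σ * (absWeight e γ z * W.eval z) with hF
  have hcont : Continuous F := by
    have : Continuous (absWeight e γ) := by
      refine continuous_finsetProd _ fun k _ => ?_
      exact (continuous_abs.comp (by fun_prop)).rpow_const fun z => Or.inr (hγ k).le
    have h2 := W.continuous
    fun_prop
  have hend : ∀ i, F (e i) = 0 := by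
    intro i
    have : absWeight e γ (e i) = 0 :=
      Finset.prod_eq_zero (Finset.mem_univ i) (by simp [Real.zero_rpow (hγ i).ne'])
    simp [hF, this]
  have hder : ∀ z ∈ Ioo (e j.castSucc) (e j.succ), HasDerivAt F
      ((lameOp e γ S * T - lameOp e γ T * S).eval z * absWeight e (fun k => γ k - 1) z) z := by
    intro z hz
    have hz' := ne_node_of_mem_Ioo he hz
    have h1 := ((hasDerivAt_absWeight γ hz').mul (W.hasDerivAt z)).const_mul (4 * σ)
    refine h1.congr_deriv ?_
    have hw : absWeight e γ z = σ * (∏ k, (z - e k)) * absWeight e (fun k => γ k - 1) z := by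
      simp only [absWeight, hσ, ← Finset.prod_mul_distrib]
      refine Finset.prod_congr rfl fun k _ => ?_
      rw [← abs_sub_node he hz, Real.rpow_sub_one (abs_ne_zero.2 (sub_ne_zero.2 (hz' k)))]
      have := abs_ne_zero.2 (sub_ne_zero.2 (hz' k))
      field_simp
    have hq : (∑ k, γ k / (z - e k)) * (∏ k, (z - e k)) =
        ∑ k, γ k * ∏ l ∈ Finset.univ.erase k, (z - e l) := by
      rw [Finset.sum_mul]
      refine Finset.sum_congr rfl fun k hk => ?_
      rw [← Finset.mul_prod_erase _ (fun k => z - e k) hk]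
      have := sub_ne_zero.2 (hz' k)
      field_simp
    have hL : (lameOp e γ S * T - lameOp e γ T * S).eval z =
        4 * (∏ k, (z - e k)) * (derivative W).eval z +
          4 * (∑ k, γ k * ∏ l ∈ Finset.univ.erase k, (z - e l)) * W.eval z := by
      rw [hdW]
      simp only [hW, lameOp, eval_sub, eval_mul, eval_add, eval_prod, eval_X, eval_C,
        eval_finsetSum, eval_ofNat]
      ring
    rw [hL, ← hq, hw]
    linear_combination (4 * absWeight e (fun k => γ k - 1) z *
      ((∑ k, γ k / (z - e k)) * (∏ k, (z - e k)) * W.eval z +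
        (∏ k, (z - e k)) * (derivative W).eval z)) * hσ2
  rw [gapMoment, intervalIntegral.integral_eq_sub_of_hasDerivAt_of_le (node_lt e he j).le
    hcont.continuousOn hder (intervalIntegrable_eval_mul_absWeight he hα j _), hend, hend, sub_zero]

end EllipsoidalS3

/-! ### Independence of the products `S(s) S(t)` of Heine-Stieltjes polynomials -/

namespace EllipsoidalS3

open Polynomial Set

lemma solvesLame_iff {e γ : Fin 4 → ℝ} {c₀ c₁ c₂ : ℝ} {w : ℝ[X]} :
    SolvesLame e γ c₀ c₁ c₂ w ↔
      lameOp e γ w = -((C c₀ * X ^ 2 + C c₁ * X + C c₂) * w) :=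
  add_eq_zero_iff_eq_neg

lemma natDegree_nodes_le (e : Fin 4 → ℝ) (s : Finset (Fin 4)) :
    (∏ k ∈ s, (X - C (e k))).natDegree ≤ s.card := by
  refine (natDegree_prod_le _ _).trans ?_
  simp

lemma coeff_nodes (e : Fin 4 → ℝ) (s : Finset (Fin 4)) :
    (∏ k ∈ s, (X - C (e k))).coeff s.card = 1 := by
  have h : (∏ k ∈ s, (X - C (e k))).Monic := monic_prod_of_monic _ _ fun k _ => monic_X_sub_C _
  have h2 : (∏ k ∈ s, (X - C (e k))).natDegree = s.card := by
    rw [natDegree_prod_of_monic _ _ fun k _ => monic_X_sub_C _]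
    simp
  rw [← h2]
  exact h

lemma natDegree_drift_le (e γ : Fin 4 → ℝ) :
    (∑ j, C (γ j) * ∏ k ∈ Finset.univ.erase j, (X - C (e k))).natDegree ≤ 3 := by
  refine natDegree_sum_le_of_forall_le _ _ fun j _ => ?_
  refine (natDegree_C_mul_le _ _).trans ((natDegree_nodes_le e _).trans ?_)
  simp

lemma coeff_drift (e γ : Fin 4 → ℝ) :
    (∑ j, C (γ j) * ∏ k ∈ Finset.univ.erase j, (X - C (e k))).coeff 3 = ∑ j, γ j := by
  rw [finsetSum_coeff]
  refine Finset.sum_congr rfl fun j _ => ?_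
  have h := coeff_nodes e (Finset.univ.erase j)
  have h2 : (Finset.univ.erase j).card = 3 := by simp
  rw [h2] at h
  rw [coeff_C_mul, h, mul_one]

lemma natDegree_lameOp_le (e γ : Fin 4 → ℝ) {w : ℝ[X]} {n : ℕ} (hw : w.natDegree ≤ n) :
    (lameOp e γ w).natDegree ≤ n + 2 := by
  have h4 : ∀ p : ℝ[X], (4 * p).natDegree ≤ p.natDegree := fun p => natDegree_C_mul_le 4 p
  have hd := natDegree_derivative_le w
  have hdd := natDegree_derivative_le (derivative w)
  by_cases hw0 : w.natDegree = 0
  · rw [natDegree_eq_zero] at hw0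
    obtain ⟨c, rfl⟩ := hw0
    simp [lameOp]
  refine natDegree_add_le_of_degree_le ?_ ?_
  · by_cases hw1 : (derivative w).natDegree = 0
    · rw [natDegree_eq_zero] at hw1
      obtain ⟨c, hc⟩ := hw1
      simp [← hc]
    refine natDegree_mul_le.trans ?_
    have := (h4 (∏ j, (X - C (e j)))).trans (natDegree_nodes_le e Finset.univ)
    simp only [Finset.card_univ, Fintype.card_fin] at this
    omega
  · refine natDegree_mul_le.trans ?_
    have := (h4 _).trans (natDegree_drift_le e γ)
    omega

/-- The coefficient that fixes the leading spectral parameter of the Lamé equation. -/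
lemma coeff_lameOp (e γ : Fin 4 → ℝ) {w : ℝ[X]} {n : ℕ} (hw : w.natDegree ≤ n) :
    (lameOp e γ w).coeff (n + 2) = (4 * n * (n - 1) + 4 * n * ∑ j, γ j) * w.coeff n := by
  have h4 : ∀ (p q : ℝ[X]) (m : ℕ), (4 * p * q).coeff m = 4 * (p * q).coeff m := fun p q m => by
    rw [mul_assoc]
    exact coeff_C_mul (a := (4 : ℝ)) _
  rcases n with _ | m
  · obtain ⟨c, rfl⟩ := natDegree_eq_zero.1 (Nat.le_zero.1 hw)
    simp [lameOp]
  have hd : (derivative w).natDegree ≤ m := (natDegree_derivative_le w).trans (by omega)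
  have h1 : ((∑ j, C (γ j) * ∏ k ∈ Finset.univ.erase j, (X - C (e k))) * derivative w).coeff
      (m + 1 + 2) = (∑ j, γ j) * (w.coeff (m + 1) * (m + 1)) := by
    rw [show m + 1 + 2 = 3 + m by ring,
      coeff_mul_add_eq_of_natDegree_le (natDegree_drift_le e γ) hd, coeff_drift, coeff_derivative]
  have h2 : ((∏ j, (X - C (e j))) * derivative (derivative w)).coeff (m + 1 + 2) =
      w.coeff (m + 1) * (m + 1) * m := by
    rcases m with _ | l
    · obtain ⟨c, hc⟩ := natDegree_eq_zero.1 (Nat.le_zero.1 hd)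
      simp [← hc]
    have hdd : (derivative (derivative w)).natDegree ≤ l :=
      (natDegree_derivative_le _).trans (by omega)
    have hP := natDegree_nodes_le e Finset.univ
    have hP' := coeff_nodes e Finset.univ
    simp only [Finset.card_univ, Fintype.card_fin] at hP hP'
    rw [show l + 1 + 1 + 2 = 4 + l by ring, coeff_mul_add_eq_of_natDegree_le hP hdd, hP',
      coeff_derivative, coeff_derivative]
    push_cast
    ring
  rw [lameOp, coeff_add, h4, h4, h1, h2]
  push_cast
  ring

lemma SolvesLame.leading_eq {e γ : Fin 4 → ℝ} {c₀ c₁ c₂ : ℝ} {w : ℝ[X]}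
    (h : SolvesLame e γ c₀ c₁ c₂ w) (hw : w ≠ 0) :
    c₀ = -(4 * w.natDegree * (w.natDegree - 1) + 4 * w.natDegree * ∑ j, γ j) := by
  have h1 := congrArg (fun p => p.coeff (w.natDegree + 2)) (solvesLame_iff.1 h)
  simp only [coeff_lameOp e γ le_rfl, coeff_neg] at h1
  rw [add_comm w.natDegree 2, coeff_mul_add_eq_of_natDegree_le natDegree_quadratic_le le_rfl] at h1
  have h2 : (C c₀ * X ^ 2 + C c₁ * X + C c₂ : ℝ[X]).coeff 2 = c₀ := by
    simp
  rw [h2] at h1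
  have h3 : w.coeff w.natDegree ≠ 0 := leadingCoeff_ne_zero.2 hw
  refine mul_right_cancel₀ h3 ?_
  linarith

lemma lameOp_sub (e γ : Fin 4 → ℝ) (S T : ℝ[X]) :
    lameOp e γ (S - T) = lameOp e γ S - lameOp e γ T := by
  simp only [lameOp, derivative_sub]
  ring

/-- A Lamé equation has at most one monic polynomial solution: the degree of a solution is
determined by `c₀`, so the difference of two monic solutions vanishes. -/
lemma SolvesLame.unique {e γ : Fin 4 → ℝ} (hγ : ∀ k, 0 < γ k) {c₀ c₁ c₂ : ℝ} {S T : ℝ[X]}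
    (hS : SolvesLame e γ c₀ c₁ c₂ S) (hT : SolvesLame e γ c₀ c₁ c₂ T) (hSm : S.Monic)
    (hTm : T.Monic) (hd : S.natDegree = T.natDegree) : S = T := by
  by_contra hne
  have h0 : S - T ≠ 0 := sub_ne_zero.2 hne
  have hsub : SolvesLame e γ c₀ c₁ c₂ (S - T) := by
    rw [solvesLame_iff] at *
    rw [lameOp_sub, hS, hT]
    ring
  have hlt : (S - T).natDegree < S.natDegree := by
    have := degree_sub_lt_left (p := S) (q := T)
      (by rw [degree_eq_natDegree hSm.ne_zero, degree_eq_natDegree hTm.ne_zero, hd])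
      hSm.ne_zero (by rw [hSm.leadingCoeff, hTm.leadingCoeff])
    exact natDegree_lt_natDegree h0 this
  have h1 := hsub.leading_eq h0
  have h2 := hS.leading_eq hSm.ne_zero
  have hΓ : 0 < ∑ j, γ j := Finset.sum_pos (fun j _ => hγ j) Finset.univ_nonempty
  have h3 : ((S - T).natDegree : ℝ) + 1 ≤ S.natDegree := by exact_mod_cast hlt
  have h4 : (0 : ℝ) ≤ (S - T).natDegree := Nat.cast_nonneg _
  set n : ℝ := ((S - T).natDegree : ℝ)
  set m : ℝ := (S.natDegree : ℝ)
  have h5 : (m - n) * (m + n - 1 + ∑ j, γ j) = 0 := by linear_combination (h2 - h1) / 4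
  have h6 : 0 < (m - n) * (m + n - 1 + ∑ j, γ j) := by
    apply mul_pos <;> linarith
  linarith

lemma gapMoment_add_smul {e γ : Fin 4 → ℝ} (he : StrictMono e) (hγ : ∀ k, 0 < γ k) (j : Fin 3)
    (a b : ℝ) (p q : ℝ[X]) :
    gapMoment e γ j (a • p + b • q) = a * gapMoment e γ j p + b * gapMoment e γ j q := by
  have h := (gapMomentₗ he hγ j).map_add (a • p) (b • q)
  rwa [map_smul, map_smul] at h

/-- The antisymmetrised pairing of moments over the first two gaps; on `f ⊗ g` it is the integral
of `(s - t) f(s) g(t)` against the product of the weights. -/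
noncomputable def gapPairing (e γ : Fin 4 → ℝ) (f g : ℝ[X]) : ℝ :=
  gapMoment e γ 0 (X * f) * gapMoment e γ 1 g - gapMoment e γ 0 f * gapMoment e γ 1 (X * g)

lemma gapPairing_self_neg {e γ : Fin 4 → ℝ} (he : StrictMono e) (hγ : ∀ k, 0 < γ k) {T : ℝ[X]}
    (hT : T ≠ 0) : gapPairing e γ (T * T) (T * T) < 0 := by
  have hTT : T * T ≠ 0 := mul_ne_zero hT hT
  have hX : X - C (e 1) ≠ 0 := X_sub_C_ne_zero _
  have h0 : 0 < gapMoment e γ 0 (-(X - C (e 1)) * (T * T)) := by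
    refine gapMoment_pos he hγ 0 (mul_ne_zero (neg_ne_zero.2 hX) hTT) fun z hz => ?_
    have : z < e 1 := hz.2
    simp only [eval_mul, eval_neg, eval_sub, eval_X, eval_C]
    exact mul_nonneg (by linarith) (mul_self_nonneg _)
  have h1 : 0 < gapMoment e γ 1 ((X - C (e 1)) * (T * T)) := by
    refine gapMoment_pos he hγ 1 (mul_ne_zero hX hTT) fun z hz => ?_
    have : e 1 < z := hz.1
    simp only [eval_mul, eval_sub, eval_X, eval_C]
    exact mul_nonneg (by linarith) (mul_self_nonneg _)
  have p0 := gapMoment_pos he hγ 0 hTT fun z _ => by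
    simpa only [eval_mul] using mul_self_nonneg _
  have p1 := gapMoment_pos he hγ 1 hTT fun z _ => by
    simpa only [eval_mul] using mul_self_nonneg _
  have e0 : gapMoment e γ 0 (-(X - C (e 1)) * (T * T)) =
      e 1 * gapMoment e γ 0 (T * T) + -1 * gapMoment e γ 0 (X * (T * T)) := by
    rw [← gapMoment_add_smul he hγ, smul_eq_C_mul, neg_one_smul]
    congr 1
    ring
  have e1 : gapMoment e γ 1 ((X - C (e 1)) * (T * T)) =
      1 * gapMoment e γ 1 (X * (T * T)) + -e 1 * gapMoment e γ 1 (T * T) := by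
    rw [← gapMoment_add_smul he hγ, one_smul, smul_eq_C_mul, C_neg]
    congr 1
    ring
  rw [e0] at h0
  rw [e1] at h1
  rw [gapPairing]
  nlinarith

/-- Orthogonality of different Heine-Stieltjes polynomials of the same degree: over each gap
`((c₁ - c₁') z + (c₂ - c₂')) S T` has moment zero, so the two rows of moments are dependent. -/
lemma gapPairing_eq_zero {e γ : Fin 4 → ℝ} (he : StrictMono e) (hγ : ∀ k, 0 < γ k) {d : ℕ}
    {S T : ℝ[X]} (hS : S ∈ heineStieltjes e γ d) (hT : T ∈ heineStieltjes e γ d) (hne : S ≠ T) :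
    gapPairing e γ (S * T) (S * T) = 0 := by
  obtain ⟨hSm, hSd, a₀, a₁, a₂, hSl⟩ := hS
  obtain ⟨hTm, hTd, b₀, b₁, b₂, hTl⟩ := hT
  have h0 : a₀ = b₀ := by
    rw [hSl.leading_eq hSm.ne_zero, hTl.leading_eq hTm.ne_zero, hSd, hTd]
  subst h0
  have key : ∀ j, (a₁ - b₁) * gapMoment e γ j (X * (S * T)) +
      (a₂ - b₂) * gapMoment e γ j (S * T) = 0 := by
    intro j
    have h1 := gapMoment_lameOp_symm he hγ j T S
    rw [solvesLame_iff.1 hSl, solvesLame_iff.1 hTl] at h1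
    rw [← gapMoment_add_smul he hγ, ← h1]
    congr 1
    simp only [smul_eq_C_mul, C_sub]
    ring
  have k0 := key 0
  have k1 := key 1
  rw [gapPairing]
  by_cases ha : a₁ = b₁
  · have hb : a₂ - b₂ ≠ 0 := by
      intro hb
      rw [← ha, ← sub_eq_zero.1 hb] at hTl
      exact hne (hSl.unique hγ hTl hSm hTm (hSd.trans hTd.symm))
    apply mul_left_cancel₀ hb
    linear_combination gapMoment e γ 0 (X * (S * T)) * k1 - gapMoment e γ 1 (X * (S * T)) * k0
  · apply mul_left_cancel₀ (sub_ne_zero.2 ha)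
    linear_combination gapMoment e γ 1 (S * T) * k0 - gapMoment e γ 0 (S * T) * k1

/-- The products `S(s) S(t)`, over the Heine-Stieltjes polynomials `S` of a given degree, are
linearly independent. -/
lemma heineStieltjes_sq_independent {e γ : Fin 4 → ℝ} (he : StrictMono e) (hγ : ∀ k, 0 < γ k)
    {d : ℕ} (t : Finset ℝ[X]) (ht : ↑t ⊆ heineStieltjes e γ d) (b : ℝ[X] → ℝ)
    (hb : ∀ i ≤ d, ∀ j ≤ d, ∑ S ∈ t, b S * (S.coeff i * S.coeff j) = 0) :
    ∀ S ∈ t, b S = 0 := by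
  intro T hT
  have hexp : ∀ (m : Fin 3) (q : ℝ[X]), ∀ S ∈ t, gapMoment e γ m (q * (S * T)) =
      ∑ i ∈ Finset.range (d + 1), S.coeff i * gapMoment e γ m (q * (X ^ i * T)) := by
    intro m q S hS
    have h1 : S = ∑ i ∈ Finset.range (d + 1), S.coeff i • (X ^ i : ℝ[X]) := by
      have := S.as_sum_range' (d + 1) (by rw [(ht hS).2.1]; omega)
      simpa only [smul_X_eq_monomial] using this
    have h2 : q * (S * T) = ∑ i ∈ Finset.range (d + 1), S.coeff i • (q * (X ^ i * T)) := by
      conv_lhs => rw [h1]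
      rw [Finset.sum_mul, Finset.mul_sum]
      simp only [smul_mul_assoc, mul_smul_comm]
    have h3 := map_sum (gapMomentₗ he hγ m)
      (fun i => S.coeff i • (q * (X ^ i * T))) (Finset.range (d + 1))
    simp only [map_smul, smul_eq_mul] at h3
    rw [← h2] at h3
    exact h3
  have hexp1 : ∀ (m : Fin 3), ∀ S ∈ t, gapMoment e γ m (S * T) =
      ∑ i ∈ Finset.range (d + 1), S.coeff i * gapMoment e γ m (X ^ i * T) := by
    intro m S hS
    simpa only [one_mul] using hexp m 1 S hS
  have hsum : ∑ S ∈ t, b S * gapPairing e γ (S * T) (S * T) = 0 := by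
    have h1 : ∀ S ∈ t, b S * gapPairing e γ (S * T) (S * T) =
        ∑ i ∈ Finset.range (d + 1), ∑ j ∈ Finset.range (d + 1),
          b S * (S.coeff i * S.coeff j) * gapPairing e γ (X ^ i * T) (X ^ j * T) := by
      intro S hS
      rw [gapPairing, hexp 0 X S hS, hexp 1 X S hS, hexp1 0 S hS, hexp1 1 S hS,
        Finset.sum_mul_sum, Finset.sum_mul_sum, ← Finset.sum_sub_distrib, Finset.mul_sum]
      refine Finset.sum_congr rfl fun i _ => ?_
      rw [← Finset.sum_sub_distrib, Finset.mul_sum]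
      refine Finset.sum_congr rfl fun j _ => ?_
      rw [gapPairing]
      ring
    rw [Finset.sum_congr rfl h1, Finset.sum_comm]
    refine Finset.sum_eq_zero fun i hi => ?_
    rw [Finset.sum_comm]
    refine Finset.sum_eq_zero fun j hj => ?_
    rw [← Finset.sum_mul, hb i (Nat.lt_succ_iff.1 (Finset.mem_range.1 hi)) j
      (Nat.lt_succ_iff.1 (Finset.mem_range.1 hj)), zero_mul]
  rw [Finset.sum_eq_single_of_mem T hT] at hsum
  · exact (mul_eq_zero.1 hsum).resolve_right
      (gapPairing_self_neg he hγ (ht hT).1.ne_zero).ne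
  · intro S hS hne
    rw [gapPairing_eq_zero he hγ (ht hS) (ht hT) hne, mul_zero]

/-- The upper bound in the Heine-Stieltjes theorem: the symmetric matrices
`S.coeff i * S.coeff j` are independent in a space of dimension `(d + 2).choose 2`. -/
lemma heineStieltjes_finset_card_le {e γ : Fin 4 → ℝ} (he : StrictMono e) (hγ : ∀ k, 0 < γ k)
    {d : ℕ} (t : Finset ℝ[X]) (ht : ↑t ⊆ heineStieltjes e γ d) :
    t.card ≤ (d + 2).choose 2 := by
  let v : t → Sym2 (Fin (d + 1)) → ℝ := fun S =>
    Sym2.lift ⟨fun i j => S.1.coeff i * S.1.coeff j, fun i j => mul_comm _ _⟩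
  have hv : LinearIndependent ℝ v := by
    rw [Fintype.linearIndependent_iff]
    intro g hg S
    have h := heineStieltjes_sq_independent he hγ t ht
      (fun T => if h : T ∈ t then g ⟨T, h⟩ else 0) ?_ S.1 S.2
    · simpa using h
    · intro i hi j hj
      have h2 := congrFun hg s((⟨i, by omega⟩ : Fin (d + 1)), ⟨j, by omega⟩)
      simp only [Finset.sum_apply, Pi.smul_apply, v, Sym2.lift_mk, smul_eq_mul, Pi.zero_apply] at h2
      rw [← Finset.sum_coe_sort t]
      simpa using h2
  have h := hv.fintype_card_le_finrank
  rw [Module.finrank_fintype_fun_eq_card, Sym2.card] at h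
  simpa using h

end EllipsoidalS3

/-! ### Stieltjes equilibria -/

namespace EllipsoidalS3

open Polynomial Set

/-- The equilibrium condition at `z` for unit charges at the points of `Z` and charges `γⱼ / 2`
at the nodes `eⱼ`. -/
def IsEquilibriumAt (e γ : Fin 4 → ℝ) (Z : Finset ℝ) (z : ℝ) : Prop :=
  ∑ j, γ j / (z - e j) + 2 * ∑ w ∈ Z.erase z, 1 / (z - w) = 0

/-- The monic polynomial with simple zeros at the points of `Z`. -/
noncomputable def rootPoly (Z : Finset ℝ) : ℝ[X] := ∏ w ∈ Z, (X - C w)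

lemma rootPoly_monic (Z : Finset ℝ) : (rootPoly Z).Monic :=
  monic_prod_of_monic _ _ fun w _ => monic_X_sub_C w

lemma natDegree_rootPoly (Z : Finset ℝ) : (rootPoly Z).natDegree = Z.card := by
  rw [rootPoly, natDegree_prod_of_monic _ _ fun w _ => monic_X_sub_C w]
  simp

lemma roots_rootPoly (Z : Finset ℝ) : (rootPoly Z).roots = Z.val :=
  roots_prod_X_sub_C Z

lemma eval_lameOp_rootPoly (e γ : Fin 4 → ℝ) {Z : Finset ℝ} {z : ℝ} (hz : z ∈ Z)
    (hze : ∀ j, z ≠ e j) :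
    (lameOp e γ (rootPoly Z)).eval z = 4 * (∏ j, (z - e j)) * (∏ w ∈ Z.erase z, (z - w)) *
      (∑ j, γ j / (z - e j) + 2 * ∑ w ∈ Z.erase z, 1 / (z - w)) := by
  set R := rootPoly (Z.erase z) with hR
  have hZ : rootPoly Z = (X - C z) * R := (Finset.mul_prod_erase Z (fun w => X - C w) hz).symm
  have hR0 : R.eval z = ∏ w ∈ Z.erase z, (z - w) := by
    simp [hR, rootPoly, eval_prod]
  have hR1 : (derivative R).eval z =
      (∏ w ∈ Z.erase z, (z - w)) * ∑ w ∈ Z.erase z, 1 / (z - w) := by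
    rw [hR, rootPoly, derivative_prod_finset, eval_finsetSum, Finset.mul_sum]
    refine Finset.sum_congr rfl fun w hw => ?_
    have hzw : z - w ≠ 0 := sub_ne_zero.2 (Finset.ne_of_mem_erase hw).symm
    rw [← Finset.mul_prod_erase _ _ hw]
    simp only [derivative_sub, derivative_X, derivative_C, eval_prod, eval_sub, eval_X,
      eval_C, sub_zero, mul_one]
    field_simp
  have hQ : ∑ j, γ j * ∏ k ∈ Finset.univ.erase j, (z - e k) =
      (∏ j, (z - e j)) * ∑ j, γ j / (z - e j) := by
    rw [Finset.mul_sum]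
    refine Finset.sum_congr rfl fun j hj => ?_
    rw [← Finset.mul_prod_erase _ (fun k => z - e k) hj]
    have := sub_ne_zero.2 (hze j)
    field_simp
  have h1 : (derivative (rootPoly Z)).eval z = R.eval z := by
    rw [hZ]
    simp
  have h2 : (derivative (derivative (rootPoly Z))).eval z = 2 * (derivative R).eval z := by
    rw [hZ]
    simp only [derivative_mul, derivative_sub, derivative_X, derivative_C, derivative_add, eval_add,
      eval_mul, eval_sub, eval_X, eval_C, sub_zero, eval_one, derivative_one]
    simp
    ring
  simp only [lameOp, eval_add, eval_mul, h1, h2, eval_prod, eval_sub, eval_X, eval_C,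
    eval_finsetSum, eval_ofNat, hQ, hR1, hR0]
  ring

/-- Equilibrium positions are zeros of a Heine-Stieltjes polynomial. -/
lemma rootPoly_mem_heineStieltjes (e γ : Fin 4 → ℝ) {Z : Finset ℝ}
    (hze : ∀ z ∈ Z, ∀ j, z ≠ e j) (hZ : ∀ z ∈ Z, IsEquilibriumAt e γ Z z) :
    rootPoly Z ∈ heineStieltjes e γ Z.card := by
  refine ⟨rootPoly_monic Z, natDegree_rootPoly Z, ?_⟩
  have hdvd : rootPoly Z ∣ lameOp e γ (rootPoly Z) := by
    refine Finset.prod_dvd_of_coprime ?_ fun z hz => ?_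
    · intro z _ w _ hzw
      exact pairwise_coprime_X_sub_C (s := fun x : ℝ => x) Function.injective_id hzw
    · rw [dvd_iff_isRoot, IsRoot, eval_lameOp_rootPoly e γ hz (hze z hz), hZ z hz, mul_zero]
  obtain ⟨q, hq⟩ := hdvd
  have hdeg : q.natDegree ≤ 2 := by
    rcases eq_or_ne q 0 with rfl | hq0
    · simp
    have h1 := natDegree_lameOp_le e γ (natDegree_rootPoly Z).le
    rw [hq, natDegree_mul (rootPoly_monic Z).ne_zero hq0, natDegree_rootPoly] at h1
    omega
  refine ⟨-q.coeff 2, -q.coeff 1, -q.coeff 0, ?_⟩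
  have h2 := eq_quadratic_of_degree_le_two (natDegree_le_iff_degree_le.1 hdeg)
  rw [solvesLame_iff, hq]
  conv_lhs => rw [h2]
  simp only [C_neg]
  ring

/-- Simple zeros of a Heine-Stieltjes polynomial away from the nodes are in equilibrium. -/
lemma isEquilibriumAt_of_solvesLame {e γ : Fin 4 → ℝ} {c₀ c₁ c₂ : ℝ} {Z : Finset ℝ}
    (h : SolvesLame e γ c₀ c₁ c₂ (rootPoly Z)) {z : ℝ} (hz : z ∈ Z) (hze : ∀ j, z ≠ e j) :
    IsEquilibriumAt e γ Z z := by
  have h1 := congrArg (eval z) (solvesLame_iff.1 h)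
  have h0 : (rootPoly Z).eval z = 0 := by
    rw [rootPoly, eval_prod]
    exact Finset.prod_eq_zero hz (by simp)
  rw [eval_lameOp_rootPoly e γ hz hze, eval_neg, eval_mul, h0, mul_zero, neg_zero] at h1
  refine (mul_eq_zero.1 h1).resolve_left ?_
  refine mul_ne_zero (mul_ne_zero (by norm_num) ?_) ?_
  · exact Finset.prod_ne_zero_iff.2 fun j _ => sub_ne_zero.2 (hze j)
  · exact Finset.prod_ne_zero_iff.2 fun w hw => sub_ne_zero.2 (Finset.ne_of_mem_erase hw).symm

lemma gap_unique {e : Fin 4 → ℝ} (he : StrictMono e) {i j : Fin 3} {z : ℝ}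
    (hi : z ∈ Ioo (e i.castSucc) (e i.succ)) (hj : z ∈ Ioo (e j.castSucc) (e j.succ)) : i = j := by
  have h1 := he.lt_iff_lt.1 (hi.1.trans hj.2)
  have h2 := he.lt_iff_lt.1 (hj.1.trans hi.2)
  rw [Fin.castSucc_lt_succ_iff] at h1 h2
  exact le_antisymm h1 h2

/-- The product of all mutual distances, with the exponents of the equilibrium problem. -/
noncomputable def stieltjesProduct (e γ : Fin 4 → ℝ) {d : ℕ} (z : Fin d → ℝ) : ℝ :=
  ∏ k, ((∏ j, |z k - e j| ^ γ j) * ∏ l ∈ Finset.univ.erase k, |z k - z l|)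

/-- The negative of the electrostatic energy, the logarithm of `stieltjesProduct`. -/
noncomputable def stieltjesLog (e γ : Fin 4 → ℝ) {d : ℕ} (z : Fin d → ℝ) : ℝ :=
  ∑ k, ((∑ j, γ j * Real.log (z k - e j)) + ∑ l ∈ Finset.univ.erase k, Real.log (z k - z l))

lemma stieltjesProduct_nonneg (e γ : Fin 4 → ℝ) {d : ℕ} (z : Fin d → ℝ) :
    0 ≤ stieltjesProduct e γ z := by
  unfold stieltjesProduct
  positivity

lemma continuous_stieltjesProduct (e : Fin 4 → ℝ) {γ : Fin 4 → ℝ} (hγ : ∀ j, 0 < γ j) (d : ℕ) :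
    Continuous (stieltjesProduct e γ : (Fin d → ℝ) → ℝ) := by
  refine continuous_finsetProd _ fun k _ => (continuous_finsetProd _ fun j _ => ?_).mul
    (continuous_finsetProd _ fun l _ => by fun_prop)
  exact Continuous.rpow_const (by fun_prop) fun z => Or.inr (hγ j).le

lemma stieltjesProduct_ne_zero_iff (e : Fin 4 → ℝ) {γ : Fin 4 → ℝ} (hγ : ∀ j, 0 < γ j) {d : ℕ}
    (z : Fin d → ℝ) :
    stieltjesProduct e γ z ≠ 0 ↔ (∀ k j, z k ≠ e j) ∧ Function.Injective z := by
  simp only [stieltjesProduct, Finset.prod_ne_zero_iff, mul_ne_zero_iff, Finset.mem_univ,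
    true_imp_iff, Finset.mem_erase, and_true, abs_ne_zero, sub_ne_zero, forall_and]
  refine and_congr (forall₂_congr fun k j => ?_) ⟨fun h k l hkl => ?_, fun h k l hkl => ?_⟩
  · rw [Real.rpow_ne_zero (abs_nonneg _) (hγ j).ne', abs_ne_zero, sub_ne_zero]
  · by_contra hne
    exact h k l (Ne.symm hne) hkl
  · exact fun h' => hkl (h h').symm

lemma log_stieltjesProduct (e : Fin 4 → ℝ) {γ : Fin 4 → ℝ} (hγ : ∀ j, 0 < γ j) {d : ℕ}
    {z : Fin d → ℝ} (hz : stieltjesProduct e γ z ≠ 0) :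
    Real.log (stieltjesProduct e γ z) = stieltjesLog e γ z := by
  obtain ⟨h1, h2⟩ := (stieltjesProduct_ne_zero_iff e hγ z).1 hz
  have p1 : ∀ k j, |z k - e j| ^ γ j ≠ 0 := fun k j =>
    (Real.rpow_pos_of_pos (abs_pos.2 (sub_ne_zero.2 (h1 k j))) _).ne'
  have p2 : ∀ k, ∀ l ∈ Finset.univ.erase k, |z k - z l| ≠ 0 := fun k l hl =>
    abs_ne_zero.2 (sub_ne_zero.2 (h2.ne (Finset.ne_of_mem_erase hl).symm))
  rw [stieltjesProduct, stieltjesLog, Real.log_prod fun k _ => mul_ne_zero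
    (Finset.prod_ne_zero_iff.2 fun j _ => p1 k j) (Finset.prod_ne_zero_iff.2 (p2 k))]
  refine Finset.sum_congr rfl fun k _ => ?_
  rw [Real.log_mul (Finset.prod_ne_zero_iff.2 fun j _ => p1 k j)
    (Finset.prod_ne_zero_iff.2 (p2 k)), Real.log_prod fun j _ => p1 k j, Real.log_prod (p2 k)]
  congr 1
  · refine Finset.sum_congr rfl fun j _ => ?_
    rw [Real.log_rpow (abs_pos.2 (sub_ne_zero.2 (h1 k j))), Real.log_abs]
  · exact Finset.sum_congr rfl fun l _ => Real.log_abs _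

lemma hasDerivAt_stieltjesLog (e γ : Fin 4 → ℝ) {d : ℕ} {z : Fin d → ℝ} (h1 : ∀ k j, z k ≠ e j)
    (h2 : Function.Injective z) (k : Fin d) :
    HasDerivAt (fun t => stieltjesLog e γ (Function.update z k t))
      (∑ j, γ j / (z k - e j) + 2 * ∑ l ∈ Finset.univ.erase k, 1 / (z k - z l)) (z k) := by
  have hu : ∀ i, HasDerivAt (fun t => Function.update z k t i) (if i = k then 1 else 0) (z k) := by
    intro i
    split_ifs with h
    · subst h
      simpa using hasDerivAt_id' (z i)
    · simpa [Function.update_of_ne h] using hasDerivAt_const (z k) (z i)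
  have hd : HasDerivAt (fun t => stieltjesLog e γ (Function.update z k t))
      (∑ i, ((∑ j, γ j * ((if i = k then 1 else 0) / (z i - e j))) +
        ∑ l ∈ Finset.univ.erase i,
          ((if i = k then 1 else 0) - (if l = k then 1 else 0)) / (z i - z l))) (z k) := by
    refine HasDerivAt.fun_sum fun i _ => (HasDerivAt.fun_sum fun j _ => ?_).add
      (HasDerivAt.fun_sum fun l hl => ?_)
    · have := ((hu i).sub_const (e j)).log (by simpa using sub_ne_zero.2 (h1 i j))
      simpa using this.const_mul (γ j)
    · have := ((hu i).sub (hu l)).log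
        (by simpa using sub_ne_zero.2 (h2.ne (Finset.ne_of_mem_erase hl).symm))
      simpa using this
  refine hd.congr_deriv ?_
  rw [Finset.sum_add_distrib]
  have s1 : ∑ i, ∑ j, γ j * ((if i = k then 1 else 0) / (z i - e j)) =
      ∑ j, γ j / (z k - e j) := by
    rw [Finset.sum_eq_single_of_mem k (Finset.mem_univ k) fun i _ hi => by simp [hi]]
    simp [div_eq_mul_inv]
  have s2 : ∑ i, ∑ l ∈ Finset.univ.erase i,
      ((if i = k then (1 : ℝ) else 0) - (if l = k then 1 else 0)) / (z i - z l) =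
      2 * ∑ l ∈ Finset.univ.erase k, 1 / (z k - z l) := by
    rw [← Finset.add_sum_erase _ _ (Finset.mem_univ k), two_mul]
    congr 1
    · refine Finset.sum_congr rfl fun l hl => ?_
      simp [Finset.ne_of_mem_erase hl]
    · refine Finset.sum_congr rfl fun i hi => ?_
      have hik := Finset.ne_of_mem_erase hi
      rw [Finset.sum_eq_single_of_mem k (by simp [hik.symm])]
      · simp only [hik, if_false, if_true, zero_sub]
        rw [neg_div, ← div_neg, neg_sub]
      · intro l _ hl
        simp [hik, hl]
  rw [s1, s2]

/-- For every assignment of the charges to gaps there is an equilibrium: a maximum of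
`stieltjesProduct` on the product of the closed gaps is positive, hence in the interior and without
collisions. -/
lemma exists_equilibrium {e γ : Fin 4 → ℝ} (he : StrictMono e) (hγ : ∀ j, 0 < γ j) {d : ℕ}
    (a : Fin d → Fin 3) : ∃ z : Fin d → ℝ, Function.Injective z ∧
      (∀ k, z k ∈ Ioo (e (a k).castSucc) (e (a k).succ)) ∧
      ∀ k, ∑ j, γ j / (z k - e j) + 2 * ∑ l ∈ Finset.univ.erase k, 1 / (z k - z l) = 0 := by
  set K : Set (Fin d → ℝ) := Set.pi univ fun k => Icc (e (a k).castSucc) (e (a k).succ) with hK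
  have hKc : IsCompact K := isCompact_univ_pi fun k => isCompact_Icc
  -- a point of the box without collisions: equidistant fractions, one for each index
  set y : Fin d → ℝ := fun k => e (a k).castSucc +
    (e (a k).succ - e (a k).castSucc) * (((k : ℝ) + 1) / (d + 1)) with hy
  have hyI : ∀ k, y k ∈ Ioo (e (a k).castSucc) (e (a k).succ) := by
    intro k
    have h0 := sub_pos.2 (node_lt e he (a k))
    have h1 : (0 : ℝ) < ((k : ℝ) + 1) / (d + 1) := by positivity
    have h2 : ((k : ℝ) + 1) / (d + 1) < 1 := by
      rw [div_lt_one (by positivity)]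
      have : (k : ℝ) < d := by exact_mod_cast k.2
      linarith
    constructor <;> simp only [hy] <;> nlinarith
  have hyinj : Function.Injective y := by
    intro k l hkl
    have hal : a k = a l := gap_unique he (hyI k) (by rw [hkl]; exact hyI l)
    have h0 := (sub_pos.2 (node_lt e he (a l))).ne'
    simp only [hy, hal, add_right_inj, mul_eq_mul_left_iff, h0, or_false] at hkl
    have hd : (d : ℝ) + 1 ≠ 0 := by positivity
    rw [div_left_inj' hd, add_left_inj, Nat.cast_inj] at hkl
    exact Fin.ext hkl
  have hyK : y ∈ K := fun k _ => Ioo_subset_Icc_self (hyI k)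
  obtain ⟨z, hzK, hzmax⟩ := hKc.exists_isMaxOn ⟨y, hyK⟩
    (continuous_stieltjesProduct e hγ d).continuousOn
  have hypos : 0 < stieltjesProduct e γ y :=
    (stieltjesProduct_nonneg e γ y).lt_of_ne'
      ((stieltjesProduct_ne_zero_iff e hγ y).2 ⟨fun k j => ne_node_of_mem_Ioo he (hyI k) j, hyinj⟩)
  have hzpos : 0 < stieltjesProduct e γ z := hypos.trans_le (hzmax hyK)
  obtain ⟨hze, hzinj⟩ := (stieltjesProduct_ne_zero_iff e hγ z).1 hzpos.ne'
  have hzI : ∀ k, z k ∈ Ioo (e (a k).castSucc) (e (a k).succ) := fun k =>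
    ⟨lt_of_le_of_ne (hzK k trivial).1 (hze k _).symm, lt_of_le_of_ne (hzK k trivial).2 (hze k _)⟩
  refine ⟨z, hzinj, hzI, fun k => ?_⟩
  have hcont : Continuous fun t => Function.update z k t := continuous_const.update k continuous_id
  have hmax : IsLocalMax (fun t => stieltjesLog e γ (Function.update z k t)) (z k) := by
    have e1 : ∀ᶠ t in nhds (z k), t ∈ Ioo (e (a k).castSucc) (e (a k).succ) :=
      isOpen_Ioo.mem_nhds (hzI k)
    have e2 : ∀ᶠ t in nhds (z k), 0 < stieltjesProduct e γ (Function.update z k t) := by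
      refine ((continuous_stieltjesProduct e hγ d).comp hcont).continuousAt.eventually
        (lt_mem_nhds ?_)
      simpa using hzpos
    filter_upwards [e1, e2] with t ht1 ht2
    simp only [Function.update_eq_self]
    rw [← log_stieltjesProduct e hγ ht2.ne', ← log_stieltjesProduct e hγ hzpos.ne']
    refine Real.log_le_log ht2 (hzmax fun i _ => ?_)
    rcases eq_or_ne i k with rfl | hi
    · simpa using Ioo_subset_Icc_self ht1
    · simpa [Function.update_of_ne hi] using hzK i trivial
  exact hmax.hasDerivAt_eq_zero (hasDerivAt_stieltjesLog e γ hze hzinj k)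

/-- For every distribution of `d` zeros over the three gaps there is a Heine-Stieltjes polynomial
with simple zeros distributed in this way. -/
lemma exists_heineStieltjes_of_distribution {e γ : Fin 4 → ℝ} (he : StrictMono e)
    (hγ : ∀ j, 0 < γ j) {d : ℕ} (a : Fin d → Fin 3) : ∃ z : Fin d → ℝ, Function.Injective z ∧
      (∀ k, z k ∈ Ioo (e (a k).castSucc) (e (a k).succ)) ∧
      rootPoly (Finset.univ.image z) ∈ heineStieltjes e γ d := by
  obtain ⟨z, hzinj, hzI, hz⟩ := exists_equilibrium he hγ a
  refine ⟨z, hzinj, hzI, ?_⟩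
  have hcard : (Finset.univ.image z).card = d := by
    rw [Finset.card_image_of_injective _ hzinj, Finset.card_univ, Fintype.card_fin]
  have h := rootPoly_mem_heineStieltjes e γ (Z := Finset.univ.image z) ?_ ?_
  · rwa [hcard] at h
  · intro w hw j
    obtain ⟨k, -, rfl⟩ := Finset.mem_image.1 hw
    exact ne_node_of_mem_Ioo he (hzI k) j
  · intro w hw
    obtain ⟨k, -, rfl⟩ := Finset.mem_image.1 hw
    rw [IsEquilibriumAt, ← Finset.image_erase hzinj, Finset.sum_image hzinj.injOn]
    exact hz k

end EllipsoidalS3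

/-! ### The Heine-Stieltjes theorem -/

namespace EllipsoidalS3

open Polynomial Set

lemma exists_map_univ_eq {α : Type*} {d : ℕ} (m : Sym α d) :
    ∃ a : Fin d → α, Finset.univ.val.map a = m.1 := by
  obtain ⟨s, hs⟩ := m
  induction s using Quotient.inductionOn with
  | h l =>
    change l.length = d at hs
    subst hs
    refine ⟨l.get, ?_⟩
    rw [Fin.univ_val_map, List.ofFn_get]
    rfl

lemma heineStieltjes_finite_ncard_le {e γ : Fin 4 → ℝ} (he : StrictMono e) (hγ : ∀ j, 0 < γ j)
    (d : ℕ) : (heineStieltjes e γ d).Finite ∧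
      (heineStieltjes e γ d).ncard ≤ (d + 2).choose 2 := by
  have hfin : (heineStieltjes e γ d).Finite := by
    by_contra hinf
    obtain ⟨t, ht, hcard⟩ := Set.Infinite.exists_subset_card_eq hinf ((d + 2).choose 2 + 1)
    have := heineStieltjes_finset_card_le he hγ t ht
    omega
  refine ⟨hfin, ?_⟩
  rw [Set.ncard_eq_toFinset_card _ hfin]
  exact heineStieltjes_finset_card_le he hγ _ (by simp)

/-- The Heine-Stieltjes theorem for four nodes: there are as many Heine-Stieltjes polynomials of
degree `d` as distributions of `d` zeros over three gaps, and each has `d` simple zeros in the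
gaps. The equilibrium polynomials reach the upper bound, so there are no others. -/
theorem heineStieltjes_count {e γ : Fin 4 → ℝ} (he : StrictMono e) (hγ : ∀ j, 0 < γ j) (d : ℕ) :
    (heineStieltjes e γ d).Finite ∧ (heineStieltjes e γ d).ncard = (d + 2).choose 2 ∧
      ∀ S ∈ heineStieltjes e γ d, ∃ Z : Finset ℝ, S = rootPoly Z ∧ Z.card = d ∧
        ∀ z ∈ Z, ∃ j : Fin 3, z ∈ Ioo (e j.castSucc) (e j.succ) := by
  classical
  obtain ⟨hfin, hle⟩ := heineStieltjes_finite_ncard_le he hγ d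
  choose a ha using fun m : Sym (Fin 3) d => exists_map_univ_eq m
  choose z hzinj hzI hzmem using fun m : Sym (Fin 3) d =>
    exists_heineStieltjes_of_distribution he hγ (a m)
  set f : Sym (Fin 3) d → ℝ[X] := fun m => rootPoly (Finset.univ.image (z m)) with hf
  have hcount : ∀ m i,
      ((f m).roots.filter (· ∈ Ioo (e i.castSucc) (e i.succ))).card = m.1.count i := by
    intro m i
    rw [hf, roots_rootPoly, ← Finset.filter_val, Finset.card_val, Finset.filter_image,
      Finset.card_image_of_injective _ (hzinj m), ← ha m, Multiset.count_map, ← Finset.filter_val,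
      Finset.card_val]
    refine congrArg _ (Finset.filter_congr fun k _ => ?_)
    exact ⟨fun h => gap_unique he h (hzI m k), fun h => by rw [h]; exact hzI m k⟩
  have hfinj : Function.Injective f := by
    intro m m' h
    refine Subtype.ext (Multiset.ext.2 fun i => ?_)
    rw [← hcount m i, ← hcount m' i, h]
  have hsub : Set.range f ⊆ heineStieltjes e γ d := by
    rintro _ ⟨m, rfl⟩
    exact hzmem m
  have hcard : (Set.range f).ncard = (d + 2).choose 2 := by
    rw [Set.ncard_range_of_injective hfinj, Nat.card_eq_fintype_card, Sym.card_sym_eq_choose,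
      Fintype.card_fin, show 3 + d - 1 = d + 2 by omega]
    exact Nat.choose_symm_add
  have heq : Set.range f = heineStieltjes e γ d :=
    Set.eq_of_subset_of_ncard_le hsub (by rw [hcard]; exact hle) hfin
  refine ⟨hfin, by rw [← heq, hcard], fun S hS => ?_⟩
  rw [← heq] at hS
  obtain ⟨m, rfl⟩ := hS
  refine ⟨_, rfl, ?_, fun w hw => ?_⟩
  · rw [Finset.card_image_of_injective _ (hzinj m), Finset.card_univ, Fintype.card_fin]
  · obtain ⟨k, -, rfl⟩ := Finset.mem_image.1 hw
    exact ⟨_, hzI m k⟩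

/-! ### Counting the states -/

lemma gammaParam_pos (μ : SymClass) (i : Fin 4) : 0 < gammaParam μ i := by
  unfold gammaParam
  split_ifs <;> norm_num

lemma gammaParam_eq (μ : SymClass) (i : Fin 4) : gammaParam μ i = 1 / 2 + ((μ i : ℕ) : ℝ) := by
  unfold gammaParam
  have h : ∀ m : Fin 2, m = 0 ∨ m = 1 := by decide
  rcases h (μ i) with h | h
  · simp [h]
  · simp [h]
    norm_num

lemma even_energy_iff (D : ℕ) : Even (D * (D + 2)) ↔ Even D := by
  simp [Nat.even_mul, Nat.even_add]

lemma mem_admissibleClasses {D : ℕ} {μ : SymClass} :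
    μ ∈ admissibleClasses D ↔ (Even μ.weight ↔ Even D) := by
  simp [admissibleClasses, even_energy_iff]

/-- The classes of even weight, by weight: one each of weight `0` and `4`, six of weight `2`. -/
lemma sum_even_weight (f : ℕ → ℕ) :
    ∑ μ ∈ Finset.univ.filter (fun μ : SymClass => Even μ.weight), f μ.weight =
      f 0 + 6 * f 2 + f 4 := by
  rw [← Finset.sum_fiberwise_of_maps_to (t := {0, 2, 4}) (g := SymClass.weight) (by decide)]
  rw [Finset.sum_congr rfl fun n _ => Finset.sum_congr rfl fun μ hμ =>
    congrArg f (Finset.mem_filter.1 hμ).2]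
  simp only [Finset.sum_const, smul_eq_mul]
  rw [Finset.sum_insert (by decide), Finset.sum_insert (by decide), Finset.sum_singleton,
    show (Finset.filter (fun i : SymClass => i.weight = 0)
      (Finset.univ.filter fun μ => Even μ.weight)).card = 1 by decide,
    show (Finset.filter (fun i : SymClass => i.weight = 2)
      (Finset.univ.filter fun μ => Even μ.weight)).card = 6 by decide,
    show (Finset.filter (fun i : SymClass => i.weight = 4)
      (Finset.univ.filter fun μ => Even μ.weight)).card = 1 by decide]
  ring

/-- The classes of odd weight, by weight: four each of weight `1` and `3`. -/
lemma sum_odd_weight (f : ℕ → ℕ) :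
    ∑ μ ∈ Finset.univ.filter (fun μ : SymClass => ¬ Even μ.weight), f μ.weight =
      4 * f 1 + 4 * f 3 := by
  rw [← Finset.sum_fiberwise_of_maps_to (t := {1, 3}) (g := SymClass.weight) (by decide)]
  rw [Finset.sum_congr rfl fun n _ => Finset.sum_congr rfl fun μ hμ =>
    congrArg f (Finset.mem_filter.1 hμ).2]
  simp only [Finset.sum_const, smul_eq_mul]
  rw [Finset.sum_insert (by decide), Finset.sum_singleton,
    show (Finset.filter (fun i : SymClass => i.weight = 1)
      (Finset.univ.filter fun μ => ¬ Even μ.weight)).card = 4 by decide,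
    show (Finset.filter (fun i : SymClass => i.weight = 3)
      (Finset.univ.filter fun μ => ¬ Even μ.weight)).card = 4 by decide]

lemma sum_admissible (D : ℕ) (f : ℕ → ℕ) : ∑ μ ∈ admissibleClasses D, f μ.weight =
    if Even D then f 0 + 6 * f 2 + f 4 else 4 * f 1 + 4 * f 3 := by
  have h : admissibleClasses D = Finset.univ.filter fun μ => (Even μ.weight ↔ Even D) := by
    ext μ
    simp [mem_admissibleClasses]
  rw [h]
  split_ifs with hD
  · simpa only [hD, iff_true] using sum_even_weight f
  · simpa only [hD, iff_false] using sum_odd_weight f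

lemma card_admissibleClasses (D : ℕ) : (admissibleClasses D).card = 8 := by
  rw [Finset.card_eq_sum_ones, sum_admissible D fun _ => 1]
  split_ifs <;> rfl

lemma weight_le (μ : SymClass) : μ.weight ≤ 4 := by
  revert μ
  decide

lemma classStates_eq {e : Fin 4 → ℝ} {D d : ℕ} {μ : SymClass} (h : 2 * d + μ.weight = D) :
    classStates e D μ = heineStieltjes e (gammaParam μ) d := by
  ext S
  refine ⟨?_, fun hS => ⟨d, h, hS⟩⟩
  rintro ⟨d', h', hS⟩
  obtain rfl : d' = d := by omega
  exact hS

lemma classStates_eq_empty {e : Fin 4 → ℝ} {D : ℕ} {μ : SymClass}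
    (h : ∀ d, 2 * d + μ.weight ≠ D) : classStates e D μ = ∅ := by
  rw [Set.eq_empty_iff_forall_notMem]
  rintro S ⟨d, hd, -⟩
  exact h d hd

lemma classStates_of_not_admissible (e : Fin 4 → ℝ) {D : ℕ} {μ : SymClass}
    (h : μ ∉ admissibleClasses D) : classStates e D μ = ∅ := by
  refine classStates_eq_empty fun d hd => h (mem_admissibleClasses.2 ?_)
  rw [← hd, Nat.even_add]
  simp

lemma classStates_finite {e : Fin 4 → ℝ} (he : StrictMono e) (D : ℕ) (μ : SymClass) :
    (classStates e D μ).Finite := by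
  by_cases h : ∃ d, 2 * d + μ.weight = D
  · obtain ⟨d, hd⟩ := h
    rw [classStates_eq hd]
    exact (heineStieltjes_count he (gammaParam_pos μ) d).1
  · rw [classStates_eq_empty (not_exists.1 h)]
    exact Set.finite_empty

lemma classStates_ncard {e : Fin 4 → ℝ} (he : StrictMono e) {D : ℕ} {μ : SymClass}
    (hμ : μ ∈ admissibleClasses D) :
    (classStates e D μ).ncard = ((D + 4 - μ.weight) / 2).choose 2 := by
  by_cases h : ∃ d, 2 * d + μ.weight = D
  · obtain ⟨d, hd⟩ := h
    rw [classStates_eq hd, (heineStieltjes_count he (gammaParam_pos μ) d).2.1]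
    congr 1
    omega
  · rw [classStates_eq_empty (not_exists.1 h), Set.ncard_empty]
    rw [mem_admissibleClasses, Nat.even_iff, Nat.even_iff] at hμ
    have hlt : D < μ.weight := by
      by_contra hle
      exact h ⟨(D - μ.weight) / 2, by omega⟩
    have := weight_le μ
    exact (Nat.choose_eq_zero_of_lt (by omega)).symm

lemma sum_classStates_ncard {e : Fin 4 → ℝ} (he : StrictMono e) (D : ℕ) :
    ∑ μ ∈ admissibleClasses D, (classStates e D μ).ncard = (D + 1) ^ 2 := by
  rw [Finset.sum_congr rfl fun μ hμ => classStates_ncard he hμ,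
    sum_admissible D fun w => ((D + 4 - w) / 2).choose 2]
  have hc : ∀ n : ℕ, 2 * n.choose 2 + n = n ^ 2 := by
    intro n
    induction n with
    | zero => rfl
    | succ n ih =>
      rw [Nat.choose_succ_succ' n 1, Nat.choose_one_right]
      linarith [ih]
  split_ifs with hD
  · obtain ⟨m, rfl⟩ := hD
    have h0 := hc (m + 2)
    have h2 := hc (m + 1)
    have h4 := hc m
    rw [show (m + m + 4 - 0) / 2 = m + 2 by omega, show (m + m + 4 - 2) / 2 = m + 1 by omega,
      show (m + m + 4 - 4) / 2 = m by omega]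
    nlinarith
  · obtain ⟨m, rfl⟩ := Nat.not_even_iff_odd.1 hD
    have h1 := hc (m + 2)
    have h3 := hc (m + 1)
    rw [show (2 * m + 1 + 4 - 1) / 2 = m + 2 by omega,
      show (2 * m + 1 + 4 - 3) / 2 = m + 1 by omega]
    nlinarith

lemma eigenstates_eq_biUnion (e : Fin 4 → ℝ) (D : ℕ) : eigenstates e D =
    ⋃ μ ∈ admissibleClasses D, (Prod.mk μ) '' classStates e D μ := by
  ext ⟨μ, S⟩
  simp only [eigenstates, mem_ofPred_eq, mem_iUnion, mem_image, Prod.mk.injEq, exists_prop]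
  refine ⟨fun h => ⟨μ, ?_, S, h, rfl, rfl⟩, ?_⟩
  · by_contra hμ
    rw [classStates_of_not_admissible e hμ] at h
    exact h
  · rintro ⟨_, -, _, h, rfl, rfl⟩
    exact h

lemma eigenstates_finite {e : Fin 4 → ℝ} (he : StrictMono e) (D : ℕ) :
    (eigenstates e D).Finite := by
  rw [eigenstates_eq_biUnion]
  exact (Finset.finite_toSet _).biUnion fun μ _ => (classStates_finite he D μ).image _

lemma eigenstates_ncard {e : Fin 4 → ℝ} (he : StrictMono e) (D : ℕ) :
    (eigenstates e D).ncard = (D + 1) ^ 2 := by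
  classical
  rw [← sum_classStates_ncard he D, Set.ncard_eq_toFinset_card _ (eigenstates_finite he D)]
  rw [Finset.card_eq_sum_card_fiberwise (f := Prod.fst) (t := admissibleClasses D)]
  · refine Finset.sum_congr rfl fun μ _ => ?_
    rw [← Set.ncard_image_of_injective (classStates e D μ) (Prod.mk_right_injective μ),
      ← Set.ncard_coe_finset]
    congr 1
    ext ⟨ν, S⟩
    simp only [Finset.coe_filter, Set.Finite.mem_toFinset, mem_ofPred_eq, mem_image, Prod.mk.injEq]
    constructor
    · rintro ⟨h, rfl⟩
      exact ⟨S, h, rfl, rfl⟩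
    · rintro ⟨_, h, rfl, rfl⟩
      exact ⟨h, rfl⟩
  · rintro ⟨μ, S⟩ h
    by_contra hμ
    have h0 : (μ, S) ∈ eigenstates e D := by simpa using h
    have h' : S ∈ classStates e D μ := h0
    rw [classStates_of_not_admissible e (by simpa using hμ)] at h'
    exact h'

end EllipsoidalS3

/-! ### The wave functions: symmetry, harmonicity, ellipsoidal coordinates -/

namespace EllipsoidalS3

open MvPolynomial

/-- The monomial `x₁^μ₁ x₂^μ₂ x₃^μ₃ x₄^μ₄`. -/
noncomputable def classMonomial (μ : SymClass) : MvPolynomial (Fin 4) ℝ := ∏ i, X i ^ (μ i : ℕ)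

/-- The product of the quadrics with parameters in `Z`. -/
noncomputable def quadricProd (e : Fin 4 → ℝ) (Z : Finset ℝ) : MvPolynomial (Fin 4) ℝ :=
  ∏ z ∈ Z, quadricForm e z

lemma waveFunction_rootPoly (e : Fin 4 → ℝ) (μ : SymClass) (Z : Finset ℝ) :
    waveFunction e μ (rootPoly Z) = classMonomial μ * quadricProd e Z := by
  rw [waveFunction, roots_rootPoly]
  rfl

lemma eval_quadricForm (e : Fin 4 → ℝ) (z : ℝ) (x : Fin 4 → ℝ) :
    eval x (quadricForm e z) = ∑ i, (∏ k ∈ Finset.univ.erase i, (z - e k)) * x i ^ 2 := by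
  simp [quadricForm]

lemma eval_waveFunction (e : Fin 4 → ℝ) (μ : SymClass) (S : Polynomial ℝ) (x : Fin 4 → ℝ) :
    eval x (waveFunction e μ S) = (∏ i, x i ^ (μ i : ℕ)) *
      (S.roots.map fun z => ∑ i, (∏ k ∈ Finset.univ.erase i, (z - e k)) * x i ^ 2).prod := by
  simp only [waveFunction, map_mul, map_prod, map_pow, eval_X, map_multiset_prod,
    Multiset.map_map, Function.comp_def, eval_quadricForm]

/-- Changing the signs of the coordinates multiplies a wave function by the character of its
symmetry class. -/
lemma eval_waveFunction_sign (e : Fin 4 → ℝ) (μ : SymClass) (S : Polynomial ℝ) (x ε : Fin 4 → ℝ)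
    (hε : ∀ i, ε i ^ 2 = 1) : eval (fun i => ε i * x i) (waveFunction e μ S) =
      (∏ i, ε i ^ (μ i : ℕ)) * eval x (waveFunction e μ S) := by
  simp only [eval_waveFunction, mul_pow, hε, one_mul, Finset.prod_mul_distrib]
  ring

lemma hasSymmetry_waveFunction (e : Fin 4 → ℝ) (μ : SymClass) (S : Polynomial ℝ) :
    HasSymmetry μ (waveFunction e μ S) := by
  intro i x
  have h := eval_waveFunction_sign e μ S x (Function.update 1 i (-1)) fun j => by
    rcases eq_or_ne j i with rfl | hj <;> simp [*]
  convert h using 2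
  · congr 1
    funext j
    rcases eq_or_ne j i with rfl | hj <;> simp [*]
  · rw [Finset.prod_eq_single i (fun j _ hj => by simp [hj]) (by simp)]
    simp

lemma isHomogeneous_quadricForm (e : Fin 4 → ℝ) (z : ℝ) : (quadricForm e z).IsHomogeneous 2 := by
  refine IsHomogeneous.sum _ _ _ fun i _ => ?_
  have h := (isHomogeneous_C (Fin 4) (∏ k ∈ Finset.univ.erase i, (z - e k))).mul
    (isHomogeneous_X_pow (R := ℝ) i 2)
  rwa [zero_add] at h

lemma isHomogeneous_waveFunction (e : Fin 4 → ℝ) (μ : SymClass) (Z : Finset ℝ) :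
    (waveFunction e μ (rootPoly Z)).IsHomogeneous (2 * Z.card + μ.weight) := by
  rw [waveFunction_rootPoly, add_comm]
  refine IsHomogeneous.mul ?_ ?_
  · exact IsHomogeneous.prod _ _ _ fun i _ => isHomogeneous_X_pow i _
  · have h := IsHomogeneous.prod Z (quadricForm e) (fun _ => 2) fun z _ =>
      isHomogeneous_quadricForm e z
    rw [Finset.sum_const, smul_eq_mul, mul_comm] at h
    exact h

lemma C_two : (C 2 : MvPolynomial (Fin 4) ℝ) = 2 := map_ofNat C 2

lemma C_four : (C 4 : MvPolynomial (Fin 4) ℝ) = 4 := map_ofNat C 4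

lemma polyLaplacian_apply (p : MvPolynomial (Fin 4) ℝ) :
    polyLaplacian p = ∑ i, pderiv i (pderiv i p) := by
  simp [polyLaplacian]

lemma polyLaplacian_mul (p q : MvPolynomial (Fin 4) ℝ) : polyLaplacian (p * q) =
    p * polyLaplacian q + 2 * ∑ i, pderiv i p * pderiv i q + q * polyLaplacian p := by
  simp only [polyLaplacian_apply, pderiv_mul, map_add, Finset.mul_sum, ← Finset.sum_add_distrib]
  refine Finset.sum_congr rfl fun i _ => ?_
  ring

lemma pderiv_finsetProd {ι : Type*} [DecidableEq ι] (i : Fin 4) (s : Finset ι)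
    (f : ι → MvPolynomial (Fin 4) ℝ) :
    pderiv i (∏ z ∈ s, f z) = ∑ z ∈ s, (∏ w ∈ s.erase z, f w) * pderiv i (f z) := by
  induction s using Finset.induction_on with
  | empty => simp
  | insert a s ha ih =>
    rw [Finset.prod_insert ha, Finset.sum_insert ha, Finset.erase_insert ha, pderiv_mul, ih,
      mul_comm (pderiv i (f a)), Finset.mul_sum]
    congr 1
    refine Finset.sum_congr rfl fun z hz => ?_
    have hza : a ≠ z := fun h => ha (h ▸ hz)
    rw [Finset.erase_insert_of_ne hza, Finset.prod_insert fun h => ha (Finset.mem_of_mem_erase h)]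
    ring

lemma pderiv_classMonomial (μ : SymClass) (i : Fin 4) : pderiv i (classMonomial μ) =
    C ((μ i : ℕ) : ℝ) * ∏ j ∈ Finset.univ.erase i, X j ^ (μ j : ℕ) := by
  rw [classMonomial, pderiv_finsetProd, Finset.sum_eq_single_of_mem i (Finset.mem_univ i)]
  · have h : ∀ m : Fin 2, m = 0 ∨ m = 1 := by decide
    rcases h (μ i) with h | h <;> simp [h]
  · intro j _ hj
    simp [pderiv_X_of_ne hj]

lemma X_mul_pderiv_classMonomial (μ : SymClass) (i : Fin 4) :
    X i * pderiv i (classMonomial μ) = C ((μ i : ℕ) : ℝ) * classMonomial μ := by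
  rw [pderiv_classMonomial, classMonomial,
    ← Finset.mul_prod_erase _ (fun j => (X j : MvPolynomial (Fin 4) ℝ) ^ (μ j : ℕ))
      (Finset.mem_univ i)]
  have h : ∀ m : Fin 2, m = 0 ∨ m = 1 := by decide
  rcases h (μ i) with h | h <;> simp [h]

lemma polyLaplacian_classMonomial (μ : SymClass) : polyLaplacian (classMonomial μ) = 0 := by
  rw [polyLaplacian_apply]
  refine Finset.sum_eq_zero fun i _ => ?_
  rw [pderiv_classMonomial, pderiv_C_mul, pderiv_finsetProd, Finset.sum_eq_zero, mul_zero]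
  intro j hj
  simp [pderiv_X_of_ne (Finset.ne_of_mem_erase hj)]

lemma pderiv_quadricForm (e : Fin 4 → ℝ) (z : ℝ) (i : Fin 4) : pderiv i (quadricForm e z) =
    2 * (C (∏ k ∈ Finset.univ.erase i, (z - e k)) * X i) := by
  rw [quadricForm, map_sum, Finset.sum_eq_single_of_mem i (Finset.mem_univ i)]
  · rw [pderiv_C_mul, pderiv_pow, pderiv_X_self]
    push_cast
    ring
  · intro j _ hj
    rw [pderiv_C_mul, pderiv_pow, pderiv_X_of_ne hj, mul_zero, mul_zero]

lemma prod_erase_node {e : Fin 4 → ℝ} {z : ℝ} (hz : ∀ j, z ≠ e j) (i : Fin 4) :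
    ∏ k ∈ Finset.univ.erase i, (z - e k) = (∏ k, (z - e k)) * (1 / (z - e i)) := by
  rw [← Finset.mul_prod_erase _ (fun k => z - e k) (Finset.mem_univ i)]
  have := sub_ne_zero.2 (hz i)
  field_simp

lemma polyLaplacian_quadricForm {e : Fin 4 → ℝ} {z : ℝ} (hz : ∀ j, z ≠ e j) :
    polyLaplacian (quadricForm e z) = C (2 * (∏ k, (z - e k)) * ∑ i, 1 / (z - e i)) := by
  rw [polyLaplacian_apply, Finset.mul_sum, map_sum]
  refine Finset.sum_congr rfl fun i _ => ?_
  rw [pderiv_quadricForm, ← C_two, pderiv_C_mul, pderiv_C_mul,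
    pderiv_X_self, mul_one, ← C_mul, prod_erase_node hz, mul_assoc]

/-- Two confocal quadrics have orthogonal gradients up to multiples of the quadrics themselves. -/
lemma sum_pderiv_quadricForm_mul {e : Fin 4 → ℝ} {z w : ℝ} (hz : ∀ j, z ≠ e j)
    (hw : ∀ j, w ≠ e j) (hzw : z ≠ w) :
    ∑ i, pderiv i (quadricForm e w) * pderiv i (quadricForm e z) =
      C (4 * (∏ k, (z - e k)) / (z - w)) * quadricForm e w +
        C (4 * (∏ k, (w - e k)) / (w - z)) * quadricForm e z := by
  simp only [pderiv_quadricForm]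
  simp only [quadricForm, Finset.mul_sum, ← Finset.sum_add_distrib]
  refine Finset.sum_congr rfl fun i _ => ?_
  have key : 4 * (∏ k ∈ Finset.univ.erase i, (w - e k)) * (∏ k ∈ Finset.univ.erase i, (z - e k)) =
      4 * (∏ k, (z - e k)) / (z - w) * (∏ k ∈ Finset.univ.erase i, (w - e k)) +
        4 * (∏ k, (w - e k)) / (w - z) * (∏ k ∈ Finset.univ.erase i, (z - e k)) := by
    rw [prod_erase_node hz, prod_erase_node hw]
    have h1 := sub_ne_zero.2 (hz i)
    have h2 := sub_ne_zero.2 (hw i)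
    have h3 := sub_ne_zero.2 hzw
    have h4 := sub_ne_zero.2 hzw.symm
    rw [← neg_sub z w, div_neg]
    field_simp
    ring
  have key' := congrArg (C (σ := Fin 4)) key
  simp only [C_add, C_mul, C_four] at key'
  linear_combination (X i ^ 2) * key'

lemma sum_sum_erase_comm {M : Type*} [AddCommMonoid M] (Z : Finset ℝ) (f : ℝ → ℝ → M) :
    ∑ z ∈ Z, ∑ w ∈ Z.erase z, f z w = ∑ z ∈ Z, ∑ w ∈ Z.erase z, f w z := by
  refine Finset.sum_comm' fun z w => ?_
  simp only [Finset.mem_erase, ne_eq]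
  tauto

lemma polyLaplacian_quadricProd {e : Fin 4 → ℝ} {Z : Finset ℝ} (hZ : ∀ z ∈ Z, ∀ j, z ≠ e j) :
    polyLaplacian (quadricProd e Z) = ∑ z ∈ Z, quadricProd e (Z.erase z) *
      C ((∏ k, (z - e k)) * (2 * ∑ i, 1 / (z - e i) + 8 * ∑ w ∈ Z.erase z, 1 / (z - w))) := by
  have h1 : polyLaplacian (quadricProd e Z) = ∑ z ∈ Z, (quadricProd e (Z.erase z) *
      polyLaplacian (quadricForm e z) + ∑ w ∈ Z.erase z, quadricProd e ((Z.erase z).erase w) *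
        ∑ i, pderiv i (quadricForm e w) * pderiv i (quadricForm e z)) := by
    simp only [polyLaplacian_apply, quadricProd]
    rw [Finset.sum_congr rfl fun i _ => by rw [pderiv_finsetProd, map_sum], Finset.sum_comm]
    refine Finset.sum_congr rfl fun z _ => ?_
    simp only [pderiv_mul, pderiv_finsetProd, Finset.sum_add_distrib, Finset.mul_sum,
      Finset.sum_mul, mul_assoc]
    rw [add_comm, Finset.sum_comm (s := Finset.univ) (t := Z.erase z)]
  have h2 : ∀ z ∈ Z, ∀ w ∈ Z.erase z, quadricProd e ((Z.erase z).erase w) *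
      ∑ i, pderiv i (quadricForm e w) * pderiv i (quadricForm e z) =
      quadricProd e (Z.erase z) * C (4 * (∏ k, (z - e k)) / (z - w)) +
        quadricProd e (Z.erase w) * C (4 * (∏ k, (w - e k)) / (w - z)) := by
    intro z hz w hw
    have hwZ := Finset.mem_of_mem_erase hw
    have hne := Finset.ne_of_mem_erase hw
    rw [sum_pderiv_quadricForm_mul (hZ z hz) (hZ w hwZ) hne.symm]
    have p1 : quadricForm e w * quadricProd e ((Z.erase z).erase w) = quadricProd e (Z.erase z) :=
      Finset.mul_prod_erase _ _ hw
    have p2 : quadricForm e z * quadricProd e ((Z.erase z).erase w) =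
        quadricProd e (Z.erase w) := by
      rw [Finset.erase_right_comm]
      exact Finset.mul_prod_erase _ _ (Finset.mem_erase.2 ⟨hne.symm, hz⟩)
    rw [← p1, ← p2]
    ring
  rw [h1, Finset.sum_add_distrib,
    Finset.sum_congr rfl fun z hz => Finset.sum_congr rfl fun w hw => h2 z hz w hw]
  simp only [Finset.sum_add_distrib]
  rw [sum_sum_erase_comm Z fun z w =>
      quadricProd e (Z.erase w) * C (4 * (∏ k, (w - e k)) / (w - z)),
    ← Finset.sum_add_distrib, ← Finset.sum_add_distrib]
  refine Finset.sum_congr rfl fun z hz => ?_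
  rw [polyLaplacian_quadricForm (hZ z hz), ← Finset.mul_sum, ← map_sum, ← mul_add, ← mul_add,
    ← C_add, ← C_add]
  congr 2
  simp only [div_eq_mul_inv, one_mul, ← Finset.mul_sum]
  ring

lemma sum_pderiv_classMonomial_mul {e : Fin 4 → ℝ} (μ : SymClass) {Z : Finset ℝ}
    (hZ : ∀ z ∈ Z, ∀ j, z ≠ e j) :
    ∑ i, pderiv i (classMonomial μ) * pderiv i (quadricProd e Z) =
      classMonomial μ * ∑ z ∈ Z, quadricProd e (Z.erase z) *
        C ((∏ k, (z - e k)) * (2 * ∑ i, ((μ i : ℕ) : ℝ) / (z - e i))) := by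
  simp only [quadricProd, pderiv_finsetProd, Finset.mul_sum]
  rw [Finset.sum_comm]
  refine Finset.sum_congr rfl fun z hz => ?_
  rw [map_sum, Finset.mul_sum, Finset.mul_sum]
  refine Finset.sum_congr rfl fun i _ => ?_
  rw [pderiv_quadricForm, prod_erase_node (hZ z hz), div_eq_mul_one_div ((μ i : ℕ) : ℝ)]
  simp only [C_mul, C_two]
  linear_combination (2 * (∏ w ∈ Z.erase z, quadricForm e w) * C (∏ k, (z - e k)) *
    C (1 / (z - e i))) * X_mul_pderiv_classMonomial μ i

/-- Niven's theorem: the equilibrium equations for the parameters of the quadrics are what makes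
the product harmonic. -/
lemma polyLaplacian_niven {e : Fin 4 → ℝ} (μ : SymClass) {Z : Finset ℝ}
    (hZ : ∀ z ∈ Z, ∀ j, z ≠ e j) (heq : ∀ z ∈ Z, IsEquilibriumAt e (gammaParam μ) Z z) :
    polyLaplacian (classMonomial μ * quadricProd e Z) = 0 := by
  rw [polyLaplacian_mul, polyLaplacian_classMonomial, mul_zero, add_zero,
    sum_pderiv_classMonomial_mul μ hZ, polyLaplacian_quadricProd hZ, mul_left_comm, ← mul_add,
    Finset.mul_sum, ← Finset.sum_add_distrib, Finset.sum_eq_zero, mul_zero]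
  intro z hz
  have h := heq z hz
  simp only [IsEquilibriumAt, gammaParam_eq, add_div, Finset.sum_add_distrib] at h
  have h2 : ∑ j, (1 / 2 : ℝ) / (z - e j) = 1 / 2 * ∑ j, 1 / (z - e j) := by
    rw [Finset.mul_sum]
    exact Finset.sum_congr rfl fun j _ => by rw [mul_one_div]
  rw [h2] at h
  rw [mul_left_comm, ← mul_add, ← C_two, ← C_mul, ← C_add]
  have h3 : (∏ k, (z - e k)) * (2 * ∑ i, 1 / (z - e i) + 8 * ∑ w ∈ Z.erase z, 1 / (z - w)) +
      2 * ((∏ k, (z - e k)) * (2 * ∑ i, ((μ i : ℕ) : ℝ) / (z - e i))) = 0 := by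
    linear_combination (4 * ∏ k, (z - e k)) * h
  rw [h3, C_0, mul_zero]

/-- A state is given by simple zeros in the gaps that are in equilibrium. -/
lemma exists_rootPoly_of_mem_eigenstates {e : Fin 4 → ℝ} (he : StrictMono e) {D : ℕ}
    {st : SymClass × Polynomial ℝ} (hst : st ∈ eigenstates e D) :
    ∃ Z : Finset ℝ, st.2 = rootPoly Z ∧ 2 * Z.card + st.1.weight = D ∧
      (∀ z ∈ Z, ∀ j, z ≠ e j) ∧ ∀ z ∈ Z, IsEquilibriumAt e (gammaParam st.1) Z z := by
  obtain ⟨d, hd, hS⟩ := hst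
  obtain ⟨Z, hSZ, hcard, hgap⟩ := (heineStieltjes_count he (gammaParam_pos st.1) d).2.2 _ hS
  have hne : ∀ z ∈ Z, ∀ j, z ≠ e j := fun z hz j => by
    obtain ⟨i, hi⟩ := hgap z hz
    exact ne_node_of_mem_Ioo he hi j
  obtain ⟨-, -, c₀, c₁, c₂, hL⟩ := hS
  rw [hSZ] at hL
  exact ⟨Z, hSZ, by rw [hcard, hd], hne, fun z hz =>
    isEquilibriumAt_of_solvesLame hL hz (hne z hz)⟩

lemma waveFunction_mem_harmonicPolys {e : Fin 4 → ℝ} (he : StrictMono e) {D : ℕ}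
    {st : SymClass × Polynomial ℝ} (hst : st ∈ eigenstates e D) :
    waveFunction e st.1 st.2 ∈ harmonicPolys D := by
  obtain ⟨Z, hZ, hD, hne, heq⟩ := exists_rootPoly_of_mem_eigenstates he hst
  refine ⟨?_, ?_⟩
  · rw [SetLike.mem_coe, mem_homogeneousSubmodule, hZ, ← hD]
    exact isHomogeneous_waveFunction e st.1 Z
  · rw [SetLike.mem_coe, LinearMap.mem_ker, hZ, waveFunction_rootPoly]
    exact polyLaplacian_niven st.1 hne heq

lemma prod_sub_div_prod (e : Fin 4 → ℝ) (s : Fin 3 → ℝ) (i : Fin 4) :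
    (∏ j, (s j - e i)) / ∏ k ∈ Finset.univ.erase i, (e k - e i) =
      (∏ j, (e i - s j)) / ∏ k ∈ Finset.univ.erase i, (e i - e k) := by
  have h1 : ∏ j, (s j - e i) = (-1) ^ 3 * ∏ j, (e i - s j) := by
    rw [← Fin.prod_const, ← Finset.prod_mul_distrib]
    exact Finset.prod_congr rfl fun j _ => by ring
  have h2 : ∏ k ∈ Finset.univ.erase i, (e k - e i) =
      (-1) ^ 3 * ∏ k ∈ Finset.univ.erase i, (e i - e k) := by
    have h3 : (Finset.univ.erase i).card = 3 := by simp
    rw [← h3, ← Finset.prod_const, ← Finset.prod_mul_distrib]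
    exact Finset.prod_congr rfl fun j _ => by ring
  rw [h1, h2, mul_div_mul_left _ _ (by norm_num)]

lemma degree_prod_X_sub_C (s : Fin 3 → ℝ) :
    (∏ j, (Polynomial.X - Polynomial.C (s j))).degree = 3 := by
  rw [Polynomial.degree_prod]
  simp

/-- In ellipsoidal coordinates the confocal quadric factorises, by Lagrange interpolation of
`∏ⱼ (z - sⱼ)` at the nodes. -/
lemma eval_quadricForm_ellipsoidal {e : Fin 4 → ℝ} (he : StrictMono e) {x : Fin 4 → ℝ}
    {s : Fin 3 → ℝ} (hx : ∀ i : Fin 4, x i ^ 2 =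
      (∏ j, (s j - e i)) / ∏ k ∈ Finset.univ.erase i, (e k - e i)) (z : ℝ) :
    eval x (quadricForm e z) = ∏ j, (z - s j) := by
  have h := Lagrange.eq_interpolate (s := Finset.univ) (v := e)
    (f := ∏ j, (Polynomial.X - Polynomial.C (s j))) he.injective.injOn (by
      rw [degree_prod_X_sub_C]
      norm_num)
  have h2 := congrArg (Polynomial.eval z) h
  simp only [Polynomial.eval_prod, Polynomial.eval_sub, Polynomial.eval_X, Polynomial.eval_C,
    Lagrange.interpolate_apply, Polynomial.eval_finsetSum, Polynomial.eval_mul, Lagrange.basis,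
    Lagrange.basisDivisor, Finset.prod_mul_distrib, Finset.prod_inv_distrib] at h2
  rw [h2, eval_quadricForm]
  refine Finset.sum_congr rfl fun i _ => ?_
  rw [hx i, prod_sub_div_prod, div_eq_mul_inv]
  ring

/-- The points with given ellipsoidal coordinates lie on the unit sphere. -/
lemma sum_ellipsoidal {e : Fin 4 → ℝ} (he : StrictMono e) (s : Fin 3 → ℝ) :
    ∑ i, (∏ j, (s j - e i)) / ∏ k ∈ Finset.univ.erase i, (e k - e i) = 1 := by
  have hm : (∏ j, (Polynomial.X - Polynomial.C (s j))).Monic :=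
    Polynomial.monic_prod_of_monic _ _ fun j _ => Polynomial.monic_X_sub_C _
  have h := Lagrange.leadingCoeff_eq_sum (s := Finset.univ) (v := e)
    (P := ∏ j, (Polynomial.X - Polynomial.C (s j))) he.injective.injOn (by
      rw [degree_prod_X_sub_C]
      norm_num)
  rw [hm.leadingCoeff] at h
  rw [h]
  refine Finset.sum_congr rfl fun i _ => ?_
  rw [prod_sub_div_prod]
  simp [Polynomial.eval_prod]

lemma eval_waveFunction_ellipsoidal {e : Fin 4 → ℝ} (he : StrictMono e) (μ : SymClass)
    (Z : Finset ℝ) {x : Fin 4 → ℝ} {s : Fin 3 → ℝ} (hx : ∀ i : Fin 4, x i ^ 2 =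
      (∏ j, (s j - e i)) / ∏ k ∈ Finset.univ.erase i, (e k - e i)) :
    eval x (waveFunction e μ (rootPoly Z)) = (-1) ^ Z.card * (∏ i, x i ^ (μ i : ℕ)) *
      ∏ j, (rootPoly Z).eval (s j) := by
  rw [waveFunction_rootPoly, map_mul, classMonomial, quadricProd, map_prod, map_prod]
  simp only [map_pow, eval_X, eval_quadricForm_ellipsoidal he hx, rootPoly, Polynomial.eval_prod,
    Polynomial.eval_sub, Polynomial.eval_X, Polynomial.eval_C]
  rw [Finset.prod_comm, mul_comm ((-1 : ℝ) ^ Z.card), mul_assoc]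
  congr 1
  have h : ∀ j, ∏ z ∈ Z, (z - s j) = (-1) ^ Z.card * ∏ z ∈ Z, (s j - z) := by
    intro j
    rw [← Finset.prod_const, ← Finset.prod_mul_distrib]
    exact Finset.prod_congr rfl fun z _ => by ring
  simp only [h, Finset.prod_mul_distrib, Fin.prod_const]
  congr 1
  rw [← pow_mul, mul_comm, pow_mul]
  norm_num

end EllipsoidalS3

/-! ### The dimension of the space of harmonic polynomials -/

namespace EllipsoidalS3

open MvPolynomial

lemma coeff_polyLaplacian (p : MvPolynomial (Fin 4) ℝ) (m : Fin 4 →₀ ℕ) :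
    coeff m (polyLaplacian p) =
      ∑ i, coeff (m + Finsupp.single i 2) p * (((m i : ℝ) + 1) * (m i + 2)) := by
  rw [polyLaplacian_apply, coeff_sum]
  refine Finset.sum_congr rfl fun i _ => ?_
  rw [coeff_pderiv, coeff_pderiv, add_assoc, ← Finsupp.single_add]
  simp only [Finsupp.add_apply, Finsupp.single_eq_same]
  push_cast
  ring

/-- A harmonic polynomial is determined by its coefficients of degree at most one in the last
variable. -/
lemma eq_zero_of_coeff_eq_zero {p : MvPolynomial (Fin 4) ℝ} (hp : polyLaplacian p = 0)
    (h : ∀ n : Fin 4 →₀ ℕ, n 3 ≤ 1 → coeff n p = 0) : p = 0 := by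
  have key : ∀ (k : ℕ) (n : Fin 4 →₀ ℕ), n 3 ≤ k → coeff n p = 0 := by
    intro k
    induction k with
    | zero => exact fun n hn => h n (hn.trans (Nat.zero_le 1))
    | succ k ih =>
      intro n hn
      by_cases h1 : n 3 ≤ 1
      · exact h n h1
      set m : Fin 4 →₀ ℕ := n - Finsupp.single 3 2 with hm
      have hnm : m + Finsupp.single 3 2 = n := by
        ext i
        by_cases hi : i = 3
        · subst hi
          simp [hm]
          omega
        · simp [hm, Finsupp.single_eq_of_ne hi]
      have hm3 : m 3 = n 3 - 2 := by simp [hm]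
      have h2 := congrArg (coeff m) hp
      rw [coeff_polyLaplacian, coeff_zero, Finset.sum_eq_single 3, hnm] at h2
      · refine (mul_eq_zero.1 h2).resolve_right ?_
        positivity
      · intro i _ hi
        rw [ih, zero_mul]
        rw [Finsupp.add_apply, Finsupp.single_eq_of_ne hi.symm, hm3]
        omega
      · simp
  ext n
  exact key (n 3) n le_rfl

/-- An enumeration by `{0, …, D}²` of the exponents of degree `D` whose last entry is `0` (below
the antidiagonal) or `1` (above it). -/
noncomputable def lowExponent (D : ℕ) (ab : Fin (D + 1) × Fin (D + 1)) : Fin 4 →₀ ℕ :=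
  Finsupp.equivFunOnFinite.symm
    (if (ab.1 : ℕ) + ab.2 ≤ D then ![(ab.1 : ℕ), ab.2, D - ab.1 - ab.2, 0]
      else ![D - ab.1, D - ab.2, ab.1 + ab.2 - 1 - D, 1])

lemma exists_lowExponent_eq {D : ℕ} {n : Fin 4 →₀ ℕ} (hn : n.degree = D) (h3 : n 3 ≤ 1) :
    ∃ ab, lowExponent D ab = n := by
  have hsum : n 0 + n 1 + n 2 + n 3 = D := by
    rw [← hn, Finsupp.degree_eq_sum, Fin.sum_univ_four]
  rcases Nat.le_one_iff_eq_zero_or_eq_one.1 h3 with h | h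
  · refine ⟨(⟨n 0, by omega⟩, ⟨n 1, by omega⟩), ?_⟩
    have hle : n 0 + n 1 ≤ D := by omega
    ext i
    fin_cases i <;> simp [lowExponent, hle, h]
    omega
  · refine ⟨(⟨D - n 0, by omega⟩, ⟨D - n 1, by omega⟩), ?_⟩
    have hle : ¬ (D - n 0 + (D - n 1) ≤ D) := by omega
    ext i
    fin_cases i <;> simp [lowExponent, hle, h] <;> omega

/-- The coefficients at the exponents `lowExponent`. -/
noncomputable def lowCoeffs (D : ℕ) :
    harmonicPolys D →ₗ[ℝ] (Fin (D + 1) × Fin (D + 1) → ℝ) :=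
  LinearMap.pi fun ab => (lcoeff ℝ (lowExponent D ab)).comp (harmonicPolys D).subtype

lemma lowCoeffs_injective (D : ℕ) : Function.Injective (lowCoeffs D) := by
  rw [← LinearMap.ker_eq_bot, LinearMap.ker_eq_bot']
  rintro ⟨p, hp⟩ h
  rw [Submodule.mk_eq_zero]
  have hhom : p.IsHomogeneous D := hp.1
  refine eq_zero_of_coeff_eq_zero hp.2 fun n hn => ?_
  by_cases hd : n.degree = D
  · obtain ⟨ab, hab⟩ := exists_lowExponent_eq hd hn
    have h2 : coeff (lowExponent D ab) p = 0 := congrFun h ab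
    rwa [hab] at h2
  · exact hhom.coeff_eq_zero hd

instance (D : ℕ) : FiniteDimensional ℝ (harmonicPolys D) :=
  FiniteDimensional.of_injective (lowCoeffs D) (lowCoeffs_injective D)

lemma finrank_harmonicPolys_le (D : ℕ) : Module.finrank ℝ (harmonicPolys D) ≤ (D + 1) ^ 2 := by
  have h := LinearMap.finrank_le_finrank_of_injective (lowCoeffs_injective D)
  rw [Module.finrank_fintype_fun_eq_card] at h
  simpa [sq] using h

/-! ### Independence of the wave functions on the sphere -/

lemma heineStieltjes_triple_independent {e γ : Fin 4 → ℝ} (he : StrictMono e)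
    (hγ : ∀ k, 0 < γ k) {d : ℕ} (t : Finset (Polynomial ℝ)) (ht : ↑t ⊆ heineStieltjes e γ d)
    (b : Polynomial ℝ → ℝ)
    (hb : ∀ s : Fin 3 → ℝ, (∀ j, s j ∈ Set.Ioo (e j.castSucc) (e j.succ)) →
      ∑ S ∈ t, b S * ∏ j, S.eval (s j) = 0) : ∀ S ∈ t, b S = 0 := by
  have hinf : ∀ j : Fin 3, (Set.Ioo (e j.castSucc) (e j.succ)).Infinite := fun j =>
    Set.Ioo_infinite (node_lt e he j)
  have hvanish : ∀ (j : Fin 3) (p : Polynomial ℝ),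
      (∀ z ∈ Set.Ioo (e j.castSucc) (e j.succ), p.eval z = 0) → p = 0 := fun j p h =>
    Polynomial.eq_zero_of_infinite_isRoot p ((hinf j).mono h)
  -- a value of the third coordinate at which no polynomial vanishes
  obtain ⟨s₂, hs₂, hs₂t⟩ : ∃ s ∈ Set.Ioo (e (2 : Fin 3).castSucc) (e (2 : Fin 3).succ),
      ∀ S ∈ t, S.eval s ≠ 0 := by
    by_contra! h
    have h0 : ∏ S ∈ t, S = 0 := hvanish 2 _ fun z hz => by
      obtain ⟨S, hS, hSz⟩ := h z hz
      rw [Polynomial.eval_prod]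
      exact Finset.prod_eq_zero hS hSz
    obtain ⟨S, hS, hS0⟩ := Finset.prod_eq_zero_iff.1 h0
    exact (ht hS).1.ne_zero hS0
  have h1 : ∀ s₀ ∈ Set.Ioo (e (0 : Fin 3).castSucc) (e (0 : Fin 3).succ),
      ∑ S ∈ t, (b S * S.eval s₂ * S.eval s₀) • S = 0 := by
    intro s₀ hs₀
    refine hvanish 1 _ fun s₁ hs₁ => ?_
    have h2 := hb ![s₀, s₁, s₂] (fun j => by fin_cases j <;> assumption)
    simp only [Fin.prod_univ_three, Matrix.cons_val_zero, Matrix.cons_val_one,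
      Matrix.cons_val] at h2
    rw [Polynomial.eval_finsetSum, ← h2]
    refine Finset.sum_congr rfl fun S _ => ?_
    rw [Polynomial.eval_smul, smul_eq_mul]
    ring
  have h2 : ∀ j, ∑ S ∈ t, (b S * S.eval s₂ * S.coeff j) • S = 0 := by
    intro j
    refine hvanish 0 _ fun s₀ hs₀ => ?_
    have h3 := congrArg (fun p => Polynomial.coeff p j) (h1 s₀ hs₀)
    simp only [Polynomial.finsetSum_coeff, Polynomial.coeff_smul, smul_eq_mul,
      Polynomial.coeff_zero] at h3
    rw [Polynomial.eval_finsetSum, ← h3]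
    refine Finset.sum_congr rfl fun S _ => ?_
    rw [Polynomial.eval_smul, smul_eq_mul]
    ring
  have h3 := heineStieltjes_sq_independent he hγ t ht (fun S => b S * S.eval s₂) ?_
  · exact fun S hS => (mul_eq_zero.1 (h3 S hS)).resolve_right (hs₂t S hS)
  · intro i _ j _
    have h4 := congrArg (fun p => Polynomial.coeff p j) (h2 i)
    simp only [Polynomial.finsetSum_coeff, Polynomial.coeff_smul, smul_eq_mul,
      Polynomial.coeff_zero] at h4
    simpa only [mul_assoc] using h4

/-- The sign vectors in four coordinates. -/
noncomputable def signVectors : Finset (Fin 4 → ℝ) := Fintype.piFinset fun _ => {1, -1}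

lemma sq_eq_one_of_mem_signVectors {ε : Fin 4 → ℝ} (hε : ε ∈ signVectors) (i : Fin 4) :
    ε i ^ 2 = 1 := by
  have h := Fintype.mem_piFinset.1 hε i
  simp only [Finset.mem_insert, Finset.mem_singleton] at h
  rcases h with h | h <;> simp [h]

/-- Orthogonality of the characters of the group of sign changes. -/
lemma sum_signVectors (μ ν : SymClass) :
    ∑ ε ∈ signVectors, (∏ i, ε i ^ (ν i : ℕ)) * ∏ i, ε i ^ (μ i : ℕ) =
      if μ = ν then 16 else 0 := by
  simp only [← Finset.prod_mul_distrib, signVectors]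
  rw [← Finset.prod_univ_sum (fun _ => ({1, -1} : Finset ℝ))
    fun i x => x ^ (ν i : ℕ) * x ^ (μ i : ℕ)]
  have hpair : ∀ f : ℝ → ℝ, ∑ x ∈ ({1, -1} : Finset ℝ), f x = f 1 + f (-1) := fun f =>
    Finset.sum_pair (by norm_num)
  simp only [hpair]
  have hcase : ∀ a b : Fin 2, (1 : ℝ) ^ (b : ℕ) * 1 ^ (a : ℕ) + (-1) ^ (b : ℕ) * (-1) ^ (a : ℕ) =
      if a = b then 2 else 0 := by
    intro a b
    fin_cases a <;> fin_cases b <;> norm_num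
  simp only [hcase]
  split_ifs with h
  · subst h
    norm_num
  · obtain ⟨i, hi⟩ := Function.ne_iff.1 h
    exact Finset.prod_eq_zero (Finset.mem_univ i) (if_neg hi)

lemma sum_sq_eq_one {x : Fin 4 → ℝ} :
    ∑ i, x i ^ 2 = 1 ↔ (WithLp.toLp 2 x : E4) ∈ S3 := by
  rw [mem_sphere_zero_iff_norm, EuclideanSpace.norm_eq, Real.sqrt_eq_one]
  simp

/-- Points with prescribed ellipsoidal coordinates in the open gaps. -/
lemma exists_ellipsoidal {e : Fin 4 → ℝ} (he : StrictMono e) {s : Fin 3 → ℝ}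
    (hs : ∀ j, s j ∈ Set.Ioo (e j.castSucc) (e j.succ)) : ∃ x : Fin 4 → ℝ, (∀ i, x i ≠ 0) ∧
      ∀ i, x i ^ 2 = (∏ j, (s j - e i)) / ∏ k ∈ Finset.univ.erase i, (e k - e i) := by
  have hpos : ∀ i, 0 < (∏ j, (s j - e i)) / ∏ k ∈ Finset.univ.erase i, (e k - e i) := by
    intro i
    -- the nodes other than `e i` are `e (i.succAbove j)`, on the same side of `e i` as `s j`
    have h1 : ∏ k ∈ Finset.univ.erase i, (e k - e i) = ∏ j, (e (i.succAbove j) - e i) := by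
      have h2 : Finset.univ.erase i = Finset.univ.image i.succAbove := by
        ext k
        simp
      rw [h2, Finset.prod_image i.succAbove_right_injective.injOn]
    rw [h1, ← Finset.prod_div_distrib]
    refine Finset.prod_pos fun j _ => ?_
    rcases lt_or_ge j.castSucc i with h | h
    · rw [Fin.succAbove_of_castSucc_lt _ _ h]
      have h3 : e j.succ ≤ e i := he.monotone (Fin.castSucc_lt_iff_succ_le.1 h)
      exact div_pos_of_neg_of_neg (by linarith [(hs j).2]) (by linarith [he h])
    · rw [Fin.succAbove_of_le_castSucc _ _ h]
      have h3 := he.monotone h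
      have h4 := node_lt e he j
      exact div_pos (by linarith [(hs j).1]) (by linarith)
  refine ⟨fun i => Real.sqrt _, fun i => (Real.sqrt_pos.2 (hpos i)).ne', fun i =>
    Real.sq_sqrt (hpos i).le⟩

/-- The restrictions of the wave functions to the sphere are linearly independent. Averaging over
sign changes separates the symmetry classes; within a class, the ellipsoidal form of the wave
functions reduces the claim to the independence of the products `S(s₁) S(s₂) S(s₃)`. -/
lemma restrict_waveFunction_linearIndepOn {e : Fin 4 → ℝ} (he : StrictMono e) (D : ℕ) :
    LinearIndepOn ℝ (fun st : SymClass × Polynomial ℝ =>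
      restrictToSphere (waveFunction e st.1 st.2)) (eigenstates e D) := by
  classical
  rw [linearIndepOn_iff']
  rintro t g ht hg ⟨ν, T⟩ hT
  have hg' : ∀ x : Fin 4 → ℝ, ∑ i, x i ^ 2 = 1 →
      ∑ st ∈ t, g st * eval x (waveFunction e st.1 st.2) = 0 := by
    intro x hx
    have := congrFun hg ⟨_, sum_sq_eq_one.1 hx⟩
    simpa [restrictToSphere] using this
  have hclass : ∀ x : Fin 4 → ℝ, ∑ i, x i ^ 2 = 1 →
      ∑ st ∈ t with st.1 = ν, g st * eval x (waveFunction e st.1 st.2) = 0 := by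
    intro x hx
    have h1 : ∑ ε ∈ signVectors, (∏ i, ε i ^ (ν i : ℕ)) *
        ∑ st ∈ t, g st * eval (fun i => ε i * x i) (waveFunction e st.1 st.2) = 0 := by
      refine Finset.sum_eq_zero fun ε hε => ?_
      rw [hg', mul_zero]
      simpa only [mul_pow, sq_eq_one_of_mem_signVectors hε, one_mul] using hx
    have h2 : ∑ ε ∈ signVectors, (∏ i, ε i ^ (ν i : ℕ)) *
        ∑ st ∈ t, g st * eval (fun i => ε i * x i) (waveFunction e st.1 st.2) =
        ∑ st ∈ t, (if st.1 = ν then 16 else 0) *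
          (g st * eval x (waveFunction e st.1 st.2)) := by
      simp only [Finset.mul_sum]
      rw [Finset.sum_comm]
      refine Finset.sum_congr rfl fun st _ => ?_
      rw [← sum_signVectors, Finset.sum_mul]
      refine Finset.sum_congr rfl fun ε hε => ?_
      rw [eval_waveFunction_sign _ _ _ _ _ (sq_eq_one_of_mem_signVectors hε)]
      ring
    rw [h2] at h1
    simp only [ite_mul, zero_mul] at h1
    rw [← Finset.sum_filter, ← Finset.mul_sum] at h1
    exact (mul_eq_zero.1 h1).resolve_left (by norm_num)
  obtain ⟨d, hd, -⟩ := ht hT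
  have hmem : ∀ S, (ν, S) ∈ t → S ∈ heineStieltjes e (gammaParam ν) d := by
    intro S hS
    have h : S ∈ classStates e D ν := ht hS
    rwa [classStates_eq hd] at h
  have h := heineStieltjes_triple_independent he (gammaParam_pos ν)
    ((t.filter fun st => st.1 = ν).image Prod.snd) (d := d) ?_ (fun S => g (ν, S)) ?_ T ?_
  · exact h
  · intro S hS
    simp only [Finset.coe_image, Finset.coe_filter, Set.mem_image, Set.mem_ofPred_eq] at hS
    obtain ⟨⟨μ, S'⟩, ⟨hS', rfl⟩, rfl⟩ := hS
    exact hmem _ hS'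
  · intro s hs
    obtain ⟨x, hx0, hx⟩ := exists_ellipsoidal he hs
    have h1 := hclass x (by simp only [hx]; exact sum_ellipsoidal he s)
    rw [Finset.sum_image]
    · have h2 : ∀ st ∈ t.filter (fun st => st.1 = ν), g st * eval x (waveFunction e st.1 st.2) =
          ((-1) ^ d * ∏ i, x i ^ (ν i : ℕ)) * (g (ν, st.2) * ∏ j, st.2.eval (s j)) := by
        rintro ⟨μ, S⟩ hst
        obtain ⟨hSt, rfl⟩ := Finset.mem_filter.1 hst
        obtain ⟨Z, hZ, hcard, -⟩ := (heineStieltjes_count he (gammaParam_pos _) d).2.2 S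
          (hmem S hSt)
        subst hZ
        rw [eval_waveFunction_ellipsoidal he _ Z hx, hcard]
        ring
      rw [Finset.sum_congr rfl h2, ← Finset.mul_sum] at h1
      refine (mul_eq_zero.1 h1).resolve_left (mul_ne_zero (pow_ne_zero _ (by norm_num)) ?_)
      exact Finset.prod_ne_zero_iff.2 fun i _ => pow_ne_zero _ (hx0 i)
    · rintro ⟨μ, S⟩ hst ⟨μ', S'⟩ hst' hSS
      have h1 := (Finset.mem_filter.1 hst).2
      have h2 := (Finset.mem_filter.1 hst').2
      exact Prod.ext (h1.trans h2.symm) hSS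
  · exact Finset.mem_image.2 ⟨(ν, T), Finset.mem_filter.2 ⟨hT, rfl⟩, rfl⟩

/-- Restriction to the sphere as a linear map. -/
noncomputable def restrictₗ : MvPolynomial (Fin 4) ℝ →ₗ[ℝ] (S3 → ℝ) where
  toFun := restrictToSphere
  map_add' p q := by
    funext x
    simp [restrictToSphere]
  map_smul' c p := by
    funext x
    simp [restrictToSphere, smul_eval]

lemma restrict_waveFunction_linearIndependent {e : Fin 4 → ℝ} (he : StrictMono e) (D : ℕ) :
    LinearIndependent ℝ fun st : eigenstates e D =>
      restrictToSphere (waveFunction e st.1.1 st.1.2) :=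
  restrict_waveFunction_linearIndepOn he D

lemma waveFunction_linearIndependent {e : Fin 4 → ℝ} (he : StrictMono e) (D : ℕ) :
    LinearIndependent ℝ fun st : eigenstates e D => waveFunction e st.1.1 st.1.2 :=
  LinearIndependent.of_comp restrictₗ (restrict_waveFunction_linearIndependent he D)

/-- There are as many independent wave functions as the dimension allows. -/
lemma span_waveFunction {e : Fin 4 → ℝ} (he : StrictMono e) (D : ℕ) :
    Submodule.span ℝ (Set.range fun st : eigenstates e D => waveFunction e st.1.1 st.1.2) =
        harmonicPolys D ∧
      Module.finrank ℝ (harmonicPolys D) = (D + 1) ^ 2 := by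
  have hfin : Fintype (eigenstates e D) := (eigenstates_finite he D).fintype
  have hle : Submodule.span ℝ (Set.range fun st : eigenstates e D =>
      waveFunction e st.1.1 st.1.2) ≤ harmonicPolys D := by
    rw [Submodule.span_le]
    rintro _ ⟨st, rfl⟩
    exact waveFunction_mem_harmonicPolys he st.2
  have hrank : Module.finrank ℝ (Submodule.span ℝ (Set.range fun st : eigenstates e D =>
      waveFunction e st.1.1 st.1.2)) = (D + 1) ^ 2 := by
    rw [finrank_span_eq_card (waveFunction_linearIndependent he D), ← Nat.card_eq_fintype_card]
    exact eigenstates_ncard he D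
  have heq := Submodule.eq_of_le_of_finrank_le hle
    ((finrank_harmonicPolys_le D).trans_eq hrank.symm)
  exact ⟨heq, by rw [← heq, hrank]⟩

end EllipsoidalS3

/-! ### Restrictions of polynomials to the sphere are sums of harmonics -/

namespace EllipsoidalS3

open MvPolynomial

/-- The polynomial `∑ xᵢ²`. -/
noncomputable def radiusSq : MvPolynomial (Fin 4) ℝ := ∑ i, X i ^ 2

lemma isHomogeneous_radiusSq : radiusSq.IsHomogeneous 2 :=
  IsHomogeneous.sum _ _ _ fun i _ => isHomogeneous_X_pow i 2

lemma pderiv_radiusSq (i : Fin 4) : pderiv i radiusSq = 2 * X i := by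
  rw [radiusSq, map_sum, Finset.sum_eq_single_of_mem i (Finset.mem_univ i)]
  · rw [pderiv_pow, pderiv_X_self]
    push_cast
    ring
  · intro j _ hj
    rw [pderiv_pow, pderiv_X_of_ne hj, mul_zero]

lemma polyLaplacian_radiusSq_mul {q : MvPolynomial (Fin 4) ℝ} {m : ℕ} (hq : q.IsHomogeneous m) :
    polyLaplacian (radiusSq * q) = radiusSq * polyLaplacian q + (4 * m + 8 : ℝ) • q := by
  have h1 : polyLaplacian radiusSq = C 8 := by
    rw [polyLaplacian_apply]
    simp only [pderiv_radiusSq, ← C_two, pderiv_C_mul, pderiv_X_self, mul_one, Fin.sum_univ_four,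
      ← C_add]
    norm_num
  have h2 : ∑ i, pderiv i radiusSq * pderiv i q = 2 * (m • q) := by
    rw [← hq.sum_X_mul_pderiv, Finset.mul_sum]
    exact Finset.sum_congr rfl fun i _ => by rw [pderiv_radiusSq, mul_assoc]
  rw [polyLaplacian_mul, h1, h2, smul_eq_C_mul, C_add, C_mul, C_four, nsmul_eq_mul,
    show (C (m : ℝ) : MvPolynomial (Fin 4) ℝ) = m from map_natCast C m]
  ring

lemma exists_polyLaplacian_radiusSq_pow {k : ℕ} {h : MvPolynomial (Fin 4) ℝ}
    (hh : h ∈ harmonicPolys k) (j : ℕ) : ∃ c : ℝ, 0 < c ∧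
      polyLaplacian (radiusSq ^ (j + 1) * h) = c • (radiusSq ^ j * h) := by
  have hhom : h.IsHomogeneous k := hh.1
  have hlap : polyLaplacian h = 0 := hh.2
  have hj : ∀ j, (radiusSq ^ j * h).IsHomogeneous (2 * j + k) := fun j =>
    (isHomogeneous_radiusSq.pow j).mul hhom
  induction j with
  | zero =>
    refine ⟨4 * k + 8, by positivity, ?_⟩
    rw [zero_add, pow_one, polyLaplacian_radiusSq_mul hhom, hlap, mul_zero, zero_add, pow_zero,
      one_mul]
  | succ j ih =>
    obtain ⟨c, hc, hcj⟩ := ih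
    refine ⟨c + (4 * (2 * (j + 1) + k : ℕ) + 8), by positivity, ?_⟩
    rw [pow_succ' radiusSq (j + 1), mul_assoc, polyLaplacian_radiusSq_mul (hj (j + 1)), hcj,
      mul_smul_comm, ← mul_assoc, ← pow_succ', ← add_smul]

/-- The span of the products `r ^ (2 j) h` of degree `n` with `h` homogeneous and harmonic. -/
noncomputable def radialHarmonicSpan (n : ℕ) : Submodule ℝ (MvPolynomial (Fin 4) ℝ) :=
  Submodule.span ℝ {p | ∃ j k, 2 * j + k = n ∧ ∃ h ∈ harmonicPolys k, p = radiusSq ^ j * h}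

lemma exists_polyLaplacian_eq {n : ℕ} {q : MvPolynomial (Fin 4) ℝ}
    (hq : q ∈ radialHarmonicSpan n) :
    ∃ p ∈ radialHarmonicSpan (n + 2), p.IsHomogeneous (n + 2) ∧ polyLaplacian p = q := by
  induction hq using Submodule.span_induction with
  | mem q hq =>
    obtain ⟨j, k, hjk, h, hh, rfl⟩ := hq
    obtain ⟨c, hc, hcj⟩ := exists_polyLaplacian_radiusSq_pow hh j
    refine ⟨c⁻¹ • (radiusSq ^ (j + 1) * h), Submodule.smul_mem _ _ (Submodule.subset_span
      ⟨j + 1, k, by omega, h, hh, rfl⟩), ?_, ?_⟩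
    · have h1 := (isHomogeneous_radiusSq.pow (j + 1)).mul (show h.IsHomogeneous k from hh.1)
      rw [show 2 * (j + 1) + k = n + 2 by omega] at h1
      exact (homogeneousSubmodule (Fin 4) ℝ (n + 2)).smul_mem _ h1
    · rw [map_smul, hcj, smul_smul, inv_mul_cancel₀ hc.ne', one_smul]
  | zero => exact ⟨0, Submodule.zero_mem _, isHomogeneous_zero _ _ _, map_zero _⟩
  | add q q' _ _ h h' =>
    obtain ⟨p, hp, hph, rfl⟩ := h
    obtain ⟨p', hp', hph', rfl⟩ := h'
    exact ⟨p + p', Submodule.add_mem _ hp hp', hph.add hph', map_add _ _ _⟩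
  | smul c q _ h =>
    obtain ⟨p, hp, hph, rfl⟩ := h
    exact ⟨c • p, Submodule.smul_mem _ _ hp,
      (homogeneousSubmodule (Fin 4) ℝ (n + 2)).smul_mem _ hph, map_smul _ _ _⟩

lemma harmonicPolys_le_radialHarmonicSpan (n : ℕ) : harmonicPolys n ≤ radialHarmonicSpan n :=
  fun h hh => Submodule.subset_span ⟨0, n, by omega, h, hh, by rw [pow_zero, one_mul]⟩

lemma isHomogeneous_polyLaplacian {n : ℕ} {p : MvPolynomial (Fin 4) ℝ}
    (hp : p.IsHomogeneous (n + 2)) : (polyLaplacian p).IsHomogeneous n := by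
  rw [polyLaplacian_apply]
  exact IsHomogeneous.sum _ _ _ fun i _ => hp.pderiv.pderiv

lemma polyLaplacian_eq_zero_of_lt {n : ℕ} (hn : n < 2) {p : MvPolynomial (Fin 4) ℝ}
    (hp : p.IsHomogeneous n) : polyLaplacian p = 0 := by
  ext m
  rw [coeff_polyLaplacian, coeff_zero]
  refine Finset.sum_eq_zero fun i _ => ?_
  rw [hp.coeff_eq_zero, zero_mul]
  rw [map_add, Finsupp.degree_single]
  omega

/-- Every homogeneous polynomial is a sum of products of powers of `r²` and harmonics: the
Laplacian of the polynomial is such a sum by induction, hence the Laplacian of another such sum,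
and the difference of the two polynomials is harmonic. -/
lemma mem_radialHarmonicSpan (n : ℕ) {p : MvPolynomial (Fin 4) ℝ} (hp : p.IsHomogeneous n) :
    p ∈ radialHarmonicSpan n := by
  induction n using Nat.strong_induction_on generalizing p with
  | _ n ih =>
    by_cases hn : n < 2
    · exact harmonicPolys_le_radialHarmonicSpan n ⟨hp, polyLaplacian_eq_zero_of_lt hn hp⟩
    obtain ⟨m, rfl⟩ : ∃ m, n = m + 2 := ⟨n - 2, by omega⟩
    obtain ⟨p', hp', hph', heq⟩ :=
      exists_polyLaplacian_eq (ih m (by omega) (isHomogeneous_polyLaplacian hp))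
    have h1 : p - p' ∈ harmonicPolys (m + 2) :=
      ⟨hp.sub hph', by rw [SetLike.mem_coe, LinearMap.mem_ker, map_sub, heq, sub_self]⟩
    have h2 := Submodule.add_mem _ (harmonicPolys_le_radialHarmonicSpan _ h1) hp'
    rwa [sub_add_cancel] at h2

/-- The restrictions of harmonic polynomials to the sphere. -/
noncomputable def sphericalHarmonics (k : ℕ) : Submodule ℝ (S3 → ℝ) :=
  (harmonicPolys k).map restrictₗ

lemma eval_radiusSq (x : S3) : eval (fun i => (x : E4) i) radiusSq = 1 := by
  have h := sum_sq_eq_one.2 (show (WithLp.toLp 2 (fun i => (x : E4) i) : E4) ∈ S3 from x.2)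
  simpa [radiusSq] using h

lemma restrict_mem_iSup_sphericalHarmonics (p : MvPolynomial (Fin 4) ℝ) :
    restrictₗ p ∈ ⨆ k, sphericalHarmonics k := by
  rw [← sum_homogeneousComponent p, map_sum]
  refine Submodule.sum_mem _ fun n _ => ?_
  have h := mem_radialHarmonicSpan n (homogeneousComponent_isHomogeneous n p)
  suffices hle : radialHarmonicSpan n ≤ (⨆ k, sphericalHarmonics k).comap restrictₗ from hle h
  rw [radialHarmonicSpan, Submodule.span_le]
  rintro _ ⟨j, k, -, h, hh, rfl⟩
  have h1 : restrictₗ (radiusSq ^ j * h) = restrictₗ h := by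
    funext x
    change eval _ _ = eval _ _
    rw [map_mul, map_pow, eval_radiusSq, one_pow, one_mul]
  rw [SetLike.mem_coe, Submodule.mem_comap, h1]
  exact Submodule.mem_iSup_of_mem k (Submodule.mem_map_of_mem hh)

/-! ### Partial derivatives and the Laplacian -/

/-- The partial derivative in the direction of the `i`-th coordinate. -/
noncomputable def partialDeriv (i : Fin 4) (f : E4 → ℝ) (y : E4) : ℝ :=
  fderiv ℝ f y (EuclideanSpace.single i 1)

lemma laplacian_eq_sum_fderiv (f : E4 → ℝ) (y : E4) : Δ f y =
    ∑ i, fderiv ℝ (fderiv ℝ f) y (EuclideanSpace.single i 1) (EuclideanSpace.single i 1) := by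
  rw [InnerProductSpace.laplacian_eq_iteratedFDeriv_orthonormalBasis f
    (EuclideanSpace.basisFun (Fin 4) ℝ)]
  simp [iteratedFDeriv_two_apply]

lemma laplacian_eq_sum_partialDeriv {f : E4 → ℝ} {y : E4} (hf : ContDiffAt ℝ 2 f y) :
    Δ f y = ∑ i, partialDeriv i (partialDeriv i f) y := by
  rw [laplacian_eq_sum_fderiv]
  refine Finset.sum_congr rfl fun i _ => ?_
  have h : DifferentiableAt ℝ (fderiv ℝ f) y :=
    (hf.fderiv_right (m := 1) (by norm_num)).differentiableAt (by norm_num)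
  have h2 := (h.hasFDerivAt.clm_apply
    (hasFDerivAt_const (EuclideanSpace.single i (1 : ℝ)) y)).fderiv
  change _ = fderiv ℝ (fun y => fderiv ℝ f y (EuclideanSpace.single i 1)) y _
  rw [h2]
  simp

lemma fderiv_eq_sum_partialDeriv (f : E4 → ℝ) (y v : E4) :
    fderiv ℝ f y v = ∑ i, v i * partialDeriv i f y := by
  have h : v = ∑ i, v i • EuclideanSpace.single i (1 : ℝ) := by
    have := (EuclideanSpace.basisFun (Fin 4) ℝ).sum_repr v
    simpa using this.symm
  conv_lhs => rw [h]
  simp [partialDeriv]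

lemma partialDeriv_mul (i : Fin 4) {f g : E4 → ℝ} {y : E4} (hf : DifferentiableAt ℝ f y)
    (hg : DifferentiableAt ℝ g y) : partialDeriv i (fun y => f y * g y) y =
      f y * partialDeriv i g y + partialDeriv i f y * g y := by
  rw [partialDeriv, (hf.hasFDerivAt.fun_mul hg.hasFDerivAt).fderiv]
  simp [partialDeriv, mul_comm]

lemma partialDeriv_add (i : Fin 4) {f g : E4 → ℝ} {y : E4} (hf : DifferentiableAt ℝ f y)
    (hg : DifferentiableAt ℝ g y) : partialDeriv i (fun y => f y + g y) y =
      partialDeriv i f y + partialDeriv i g y := by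
  rw [partialDeriv, (hf.hasFDerivAt.fun_add hg.hasFDerivAt).fderiv]
  simp [partialDeriv]

lemma partialDeriv_congr (i : Fin 4) {f g : E4 → ℝ} {y : E4} (h : f =ᶠ[nhds y] g) :
    partialDeriv i f y = partialDeriv i g y := by
  rw [partialDeriv, h.fderiv_eq, partialDeriv]

lemma partialDeriv_coord (i j : Fin 4) (y : E4) :
    partialDeriv i (fun y => y j) y = if i = j then 1 else 0 := by
  change fderiv ℝ (EuclideanSpace.proj j : E4 →L[ℝ] ℝ) y _ = _
  rw [ContinuousLinearMap.fderiv]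
  simp [eq_comm]

/-- The polynomial function on Euclidean space. -/
noncomputable def polyFun (p : MvPolynomial (Fin 4) ℝ) (y : E4) : ℝ := eval (fun i => y i) p

lemma contDiff_coord (i : Fin 4) {n : WithTop ℕ∞} : ContDiff ℝ n fun y : E4 => y i :=
  (EuclideanSpace.proj i : E4 →L[ℝ] ℝ).contDiff

lemma contDiff_polyFun (p : MvPolynomial (Fin 4) ℝ) {n : WithTop ℕ∞} :
    ContDiff ℝ n (polyFun p) := by
  unfold polyFun
  induction p using MvPolynomial.induction_on with
  | C a => simpa using contDiff_const
  | add p q hp hq => simpa using hp.add hq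
  | mul_X p i hp => simpa using hp.mul (contDiff_coord i)

lemma differentiable_polyFun (p : MvPolynomial (Fin 4) ℝ) : Differentiable ℝ (polyFun p) :=
  (contDiff_polyFun p (n := 1)).differentiable (by norm_num)

lemma partialDeriv_polyFun (i : Fin 4) (p : MvPolynomial (Fin 4) ℝ) (y : E4) :
    partialDeriv i (polyFun p) y = polyFun (pderiv i p) y := by
  induction p using MvPolynomial.induction_on with
  | C a =>
    have h : polyFun (C a) = fun _ => a := by
      funext y
      simp [polyFun]
    rw [h]
    simp [partialDeriv, polyFun]
  | add p q hp hq =>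
    have h : polyFun (p + q) = fun y => polyFun p y + polyFun q y := by
      funext y
      simp [polyFun]
    rw [h, partialDeriv_add i (differentiable_polyFun p y) (differentiable_polyFun q y), hp, hq]
    simp [polyFun]
  | mul_X p j hp =>
    have h : polyFun (p * X j) = fun y => polyFun p y * y j := by
      funext y
      simp [polyFun]
    rw [h, partialDeriv_mul i (differentiable_polyFun p y)
      ((contDiff_coord j (n := 1)).differentiable (by norm_num) y), hp,
      partialDeriv_coord, pderiv_mul]
    by_cases hij : i = j
    · subst hij
      simp [polyFun]
      ring
    · simp [polyFun, hij, pderiv_X_of_ne (Ne.symm hij)]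

/-- Powers of the squared radius. -/
noncomputable def radialPow (a : ℝ) (y : E4) : ℝ := (‖y‖ ^ 2) ^ a

lemma contDiffAt_radialPow (a : ℝ) {y : E4} (hy : y ≠ 0) {n : WithTop ℕ∞} :
    ContDiffAt ℝ n (radialPow a) y :=
  (contDiff_norm_sq ℝ).contDiffAt.rpow_const_of_ne (by simpa using hy)

lemma partialDeriv_radialPow (i : Fin 4) (a : ℝ) {y : E4} (hy : y ≠ 0) :
    partialDeriv i (radialPow a) y = 2 * a * y i * radialPow (a - 1) y := by
  have h := ((hasStrictFDerivAt_norm_sq y).hasFDerivAt.rpow_const (p := a)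
    (Or.inl (by simpa using hy))).fderiv
  rw [partialDeriv, radialPow, show radialPow a = fun y => (‖y‖ ^ 2) ^ a from rfl, h]
  simp [EuclideanSpace.inner_single_right]
  ring

/-! ### Harmonic polynomials solve the Schrödinger equation -/

lemma radialExtension_of_ne (f : S3 → ℝ) {y : E4} (hy : y ≠ 0) : radialExtension f y =
    f ⟨‖y‖⁻¹ • y, by simp [norm_smul, norm_ne_zero_iff.mpr hy]⟩ := by
  rw [radialExtension, dif_neg hy]

lemma ne_zero_of_mem_S3 (x : S3) : (x : E4) ≠ 0 := by
  have h := x.2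
  rw [mem_sphere_zero_iff_norm] at h
  exact norm_ne_zero_iff.1 (by rw [h]; norm_num)

lemma radialExtension_coe (f : S3 → ℝ) (x : S3) : radialExtension f x = f x := by
  have h := x.2
  rw [mem_sphere_zero_iff_norm] at h
  rw [radialExtension_of_ne f (ne_zero_of_mem_S3 x)]
  congr 1
  ext1
  simp [h]

lemma radialExtension_smul (f : S3 → ℝ) {c : ℝ} (hc : 0 < c) (y : E4) :
    radialExtension f (c • y) = radialExtension f y := by
  by_cases hy : y = 0
  · simp [hy]
  rw [radialExtension_of_ne f hy, radialExtension_of_ne f (smul_ne_zero hc.ne' hy)]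
  congr 2
  rw [norm_smul, Real.norm_of_nonneg hc.le, smul_smul, mul_inv, mul_right_comm,
    inv_mul_cancel₀ hc.ne', one_mul]

lemma radialExtension_add (f g : S3 → ℝ) (y : E4) :
    radialExtension (f + g) y = radialExtension f y + radialExtension g y := by
  unfold radialExtension
  split_ifs <;> simp

lemma radialExtension_const_smul (c : ℝ) (f : S3 → ℝ) (y : E4) :
    radialExtension (c • f) y = c * radialExtension f y := by
  unfold radialExtension
  split_ifs <;> simp

lemma polyFun_smul {p : MvPolynomial (Fin 4) ℝ} {n : ℕ} (hp : p.IsHomogeneous n) (c : ℝ) (y : E4) :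
    polyFun p (c • y) = c ^ n * polyFun p y := by
  simp only [polyFun, eval_eq', Finset.mul_sum]
  refine Finset.sum_congr rfl fun m hm => ?_
  have h : ∑ i, m i = n := by
    rw [← Finsupp.degree_eq_sum]
    by_contra hne
    exact mem_support_iff.1 hm (hp.coeff_eq_zero hne)
  simp only [PiLp.smul_apply, smul_eq_mul, mul_pow, Finset.prod_mul_distrib,
    Finset.prod_pow_eq_pow_sum, h]
  ring

lemma radialExtension_restrict {p : MvPolynomial (Fin 4) ℝ} {n : ℕ} (hp : p.IsHomogeneous n)
    {y : E4} (hy : y ≠ 0) :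
    radialExtension (restrictToSphere p) y = radialPow (-n / 2) y * polyFun p y := by
  rw [radialExtension_of_ne _ hy]
  change polyFun p (‖y‖⁻¹ • y) = _
  rw [polyFun_smul hp]
  congr 1
  rw [radialPow, ← Real.rpow_natCast ‖y‖ 2, ← Real.rpow_mul (norm_nonneg y), inv_pow,
    ← Real.rpow_natCast, ← Real.rpow_neg (norm_nonneg y)]
  congr 1
  push_cast
  ring

lemma isC2OnSphere_restrict {p : MvPolynomial (Fin 4) ℝ} {n : ℕ} (hp : p.IsHomogeneous n) :
    IsC2OnSphere (restrictToSphere p) := by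
  refine ContDiffOn.congr (f := fun y => radialPow (-n / 2) y * polyFun p y) ?_ fun y hy =>
    radialExtension_restrict hp hy
  intro y hy
  exact ((contDiffAt_radialPow _ hy).mul (contDiff_polyFun p).contDiffAt).contDiffWithinAt

lemma laplaceBeltrami_restrict {p : MvPolynomial (Fin 4) ℝ} {n : ℕ} (hp : p ∈ harmonicPolys n)
    (x : S3) :
    laplaceBeltrami (restrictToSphere p) x = -(n * (n + 2)) * restrictToSphere p x := by
  have hhom : p.IsHomogeneous n := hp.1
  have hlap : polyLaplacian p = 0 := hp.2
  have hx0 := ne_zero_of_mem_S3 x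
  have hx1 : ∀ a, radialPow a x = 1 := fun a => by
    have h := x.2
    rw [mem_sphere_zero_iff_norm] at h
    simp [radialPow, h]
  have hopen : ∀ {y : E4}, y ≠ 0 → ∀ᶠ w in nhds y, w ≠ 0 := fun hy => isOpen_ne.mem_nhds hy
  set a : ℝ := -n / 2 with ha
  set u := radialExtension (restrictToSphere p) with hu
  have hua : ∀ y, y ≠ 0 → u y = radialPow a y * polyFun p y := fun y hy =>
    radialExtension_restrict hhom hy
  have hdr : ∀ b {y : E4}, y ≠ 0 → DifferentiableAt ℝ (radialPow b) y := fun b y hy =>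
    (contDiffAt_radialPow b hy (n := 1)).differentiableAt (by norm_num)
  have hdc : ∀ i (y : E4), DifferentiableAt ℝ (fun y : E4 => y i) y := fun i y =>
    (contDiff_coord i (n := 1)).differentiable (by norm_num) y
  have hpd : ∀ i y, y ≠ 0 → partialDeriv i u y = radialPow a y * polyFun (pderiv i p) y +
      2 * a * (y i * (radialPow (a - 1) y * polyFun p y)) := by
    intro i y hy
    rw [partialDeriv_congr i ((hopen hy).mono hua),
      partialDeriv_mul i (hdr a hy) (differentiable_polyFun p y), partialDeriv_polyFun,
      partialDeriv_radialPow i a hy]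
    ring
  have hpd2 : ∀ i, partialDeriv i (partialDeriv i u) x =
      polyFun (pderiv i (pderiv i p)) x + 4 * a * (x.1 i * polyFun (pderiv i p) x) +
        2 * a * polyFun p x + 4 * a * (a - 1) * polyFun p x * (x.1 i) ^ 2 := by
    intro i
    have hc : ∀ f : E4 → ℝ, DifferentiableAt ℝ f x →
        partialDeriv i (fun y => 2 * a * f y) x = 2 * a * partialDeriv i f x := fun f hf => by
      rw [partialDeriv_mul i (differentiableAt_const _) hf]
      simp [partialDeriv]
    have d1 := (hdr (a - 1) hx0).fun_mul (differentiable_polyFun p x)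
    have d2 := (hdc i x).fun_mul d1
    rw [partialDeriv_congr i ((hopen hx0).mono (hpd i)), partialDeriv_add i
      ((hdr a hx0).fun_mul (differentiable_polyFun _ x)) (d2.const_mul _), hc _ d2,
      partialDeriv_mul i (hdr a hx0) (differentiable_polyFun _ x),
      partialDeriv_mul i (hdc i x) d1,
      partialDeriv_mul i (hdr _ hx0) (differentiable_polyFun _ x), partialDeriv_coord, if_pos rfl,
      partialDeriv_radialPow i _ hx0, partialDeriv_radialPow i _ hx0, partialDeriv_polyFun,
      partialDeriv_polyFun, hx1, hx1, hx1]
    ring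
  have hC2 : ContDiffAt ℝ 2 u x :=
    (isC2OnSphere_restrict hhom).contDiffAt (isOpen_compl_singleton.mem_nhds hx0)
  have hE : ∑ i, x.1 i * polyFun (pderiv i p) x = n * polyFun p x := by
    have h := congrArg (fun q => polyFun q x) hhom.sum_X_mul_pderiv
    simpa [polyFun] using h
  have hL : ∑ i, polyFun (pderiv i (pderiv i p)) x = 0 := by
    have h := congrArg (fun q => polyFun q x) hlap
    rw [polyLaplacian_apply] at h
    simpa [polyFun] using h
  have hS : ∑ i, (x.1 i) ^ 2 = 1 := sum_sq_eq_one.2 x.2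
  rw [laplaceBeltrami, laplacian_eq_sum_partialDeriv hC2, Finset.sum_congr rfl fun i _ => hpd2 i,
    Finset.sum_add_distrib, Finset.sum_add_distrib, Finset.sum_add_distrib, ← Finset.mul_sum,
    ← Finset.mul_sum, ← Finset.mul_sum, hL, hE, hS, Finset.sum_const, Finset.card_univ,
    Fintype.card_fin,
    show restrictToSphere p x = polyFun p x from rfl, ha]
  simp only [nsmul_eq_mul]
  push_cast
  ring

lemma isSchrodingerSolution_restrict (hbar : ℝ) {p : MvPolynomial (Fin 4) ℝ} {n : ℕ}
    (hp : p ∈ harmonicPolys n) :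
    IsSchrodingerSolution hbar (hbar ^ 2 * (n * (n + 2))) (restrictToSphere p) := by
  refine ⟨isC2OnSphere_restrict hp.1, fun x => ?_⟩
  rw [laplaceBeltrami_restrict hp]
  ring

end EllipsoidalS3

/-! ### Green's identity for functions that are constant along rays -/

namespace EllipsoidalS3

open MeasureTheory

/-- Twice continuously differentiable off the origin and constant along rays. -/
def IsRayConstantC2 (u : E4 → ℝ) : Prop :=
  ContDiffOn ℝ 2 u {0}ᶜ ∧ ∀ c : ℝ, 0 < c → ∀ y, u (c • y) = u y

lemma isRayConstantC2_radialExtension {f : S3 → ℝ} (hf : IsC2OnSphere f) :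
    IsRayConstantC2 (radialExtension f) :=
  ⟨hf, fun _ hc y => radialExtension_smul f hc y⟩

lemma IsRayConstantC2.contDiffAt {u : E4 → ℝ} (hu : IsRayConstantC2 u) {y : E4} (hy : y ≠ 0) :
    ContDiffAt ℝ 2 u y :=
  hu.1.contDiffAt (isOpen_compl_singleton.mem_nhds hy)

lemma IsRayConstantC2.differentiableAt {u : E4 → ℝ} (hu : IsRayConstantC2 u) {y : E4}
    (hy : y ≠ 0) : DifferentiableAt ℝ u y :=
  (hu.contDiffAt hy).differentiableAt (by norm_num)

lemma IsRayConstantC2.contDiffOn_partialDeriv {u : E4 → ℝ} (hu : IsRayConstantC2 u) (i : Fin 4) :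
    ContDiffOn ℝ 1 (partialDeriv i u) {0}ᶜ :=
  (hu.1.fderiv_of_isOpen isOpen_compl_singleton (by norm_num)).clm_apply contDiffOn_const

lemma IsRayConstantC2.sum_coord_mul_partialDeriv {u : E4 → ℝ} (hu : IsRayConstantC2 u) {y : E4}
    (hy : y ≠ 0) : ∑ i, y i * partialDeriv i u y = 0 := by
  rw [← fderiv_eq_sum_partialDeriv]
  have h1 : HasDerivAt (fun t : ℝ => t • y) ((1 : ℝ) • y) 1 := (hasDerivAt_id' (1 : ℝ)).smul_const y
  have h2 : HasFDerivAt u (fderiv ℝ u y) ((1 : ℝ) • y) := by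
    rw [one_smul]
    exact (hu.differentiableAt hy).hasFDerivAt
  have h3 := h2.comp_hasDerivAt (1 : ℝ) h1
  have h4 : u ∘ (fun t : ℝ => t • y) =ᶠ[nhds 1] fun _ => u y := by
    filter_upwards [lt_mem_nhds (zero_lt_one' ℝ)] with t ht
    exact hu.2 t ht y
  have h5 := h3.unique ((hasDerivAt_const (1 : ℝ) (u y)).congr_of_eventuallyEq h4)
  simpa using h5

lemma IsRayConstantC2.laplacian_smul {u : E4 → ℝ} (hu : IsRayConstantC2 u) {c : ℝ} (hc : 0 < c)
    (y : E4) : Δ u y = c ^ 2 * Δ u (c • y) := by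
  have h1 : fderiv ℝ u = fun y => c • fderiv ℝ u (c • y) := by
    funext y
    have h : u = fun y => u (c • y) := funext fun y => (hu.2 c hc y).symm
    conv_lhs => rw [h]
    exact fderiv_comp_smul c
  have h2 : fderiv ℝ (fderiv ℝ u) y = c • c • fderiv ℝ (fderiv ℝ u) (c • y) := by
    conv_lhs => rw [h1]
    have : Invertible c := invertibleOfNonzero hc.ne'
    have h3 := fderiv_const_smul_of_invertible (𝕜 := ℝ) (f := fun y => fderiv ℝ u (c • y))
      (x := y) c
    exact h3.trans (by rw [fderiv_comp_smul c (f := fderiv ℝ u)])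
  rw [laplacian_eq_sum_fderiv, laplacian_eq_sum_fderiv, Finset.mul_sum]
  refine Finset.sum_congr rfl fun i _ => ?_
  rw [h2]
  simp only [FunLike.coe_smul, Pi.smul_apply, smul_eq_mul]
  ring

/-- A smooth radial cutoff function: `1` on the unit sphere and supported in an annulus. -/
noncomputable def annulusBump (y : E4) : ℝ :=
  (⟨1 / 4, 1 / 2, by norm_num, by norm_num⟩ : ContDiffBump (1 : ℝ)) (‖y‖ ^ 2)

lemma contDiff_annulusBump {n : ℕ∞} : ContDiff ℝ n annulusBump :=
  (ContDiffBump.contDiff _).comp (contDiff_norm_sq ℝ)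

lemma annulusBump_nonneg (y : E4) : 0 ≤ annulusBump y := ContDiffBump.nonneg _

lemma annulusBump_of_mem (x : S3) : annulusBump x = 1 := by
  have h := x.2
  rw [mem_sphere_zero_iff_norm] at h
  refine ContDiffBump.one_of_mem_closedBall _ ?_
  simp [h]

lemma tsupport_annulusBump_subset :
    tsupport annulusBump ⊆ {y | 1 / 2 ≤ ‖y‖ ^ 2 ∧ ‖y‖ ^ 2 ≤ 3 / 2} := by
  refine closure_minimal ?_ ?_
  · intro y hy
    by_contra h
    refine hy (ContDiffBump.zero_of_le_dist _ ?_)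
    simp only [Real.dist_eq]
    by_contra h'
    rw [not_le, abs_lt] at h'
    exact h ⟨by linarith [h'.1], by linarith [h'.2]⟩
  · have h : Continuous fun y : E4 => ‖y‖ ^ 2 := by fun_prop
    exact (isClosed_le continuous_const h).inter (isClosed_le h continuous_const)

lemma hasCompactSupport_annulusBump : HasCompactSupport annulusBump := by
  refine HasCompactSupport.of_support_subset_isCompact (isCompact_closedBall (0 : E4) 2) ?_
  intro y hy
  have h := (tsupport_annulusBump_subset (subset_tsupport _ hy)).2
  rw [mem_closedBall_zero_iff]
  nlinarith [norm_nonneg y]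

lemma ne_zero_of_mem_tsupport {y : E4} (hy : y ∈ tsupport annulusBump) : y ≠ 0 := by
  rintro rfl
  have := (tsupport_annulusBump_subset hy).1
  norm_num at this

lemma continuous_mul_of_tsupport {κ h : E4 → ℝ} (hκ : Continuous κ)
    (hs : tsupport κ ⊆ tsupport annulusBump) (hh : ContinuousOn h {0}ᶜ) :
    Continuous fun y => κ y * h y := by
  have h1 : tsupport (fun y => κ y * h y) ⊆ ({0}ᶜ : Set E4) :=
    (tsupport_mul_subset_left.trans hs).trans fun y hy => ne_zero_of_mem_tsupport hy
  exact (hκ.continuousOn.mul hh).continuous_of_tsupport_subset isOpen_compl_singleton h1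

lemma hasCompactSupport_mul_of_tsupport {κ : E4 → ℝ} (h : E4 → ℝ)
    (hs : tsupport κ ⊆ tsupport annulusBump) : HasCompactSupport fun y => κ y * h y := by
  have h1 : HasCompactSupport κ :=
    hasCompactSupport_annulusBump.of_isClosed_subset (isClosed_tsupport κ) hs
  exact h1.mul_right

lemma integrable_mul_of_tsupport {κ h : E4 → ℝ} (hκ : Continuous κ)
    (hs : tsupport κ ⊆ tsupport annulusBump) (hh : ContinuousOn h {0}ᶜ) :
    Integrable fun y => κ y * h y :=
  (continuous_mul_of_tsupport hκ hs hh).integrable_of_hasCompactSupport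
    (hasCompactSupport_mul_of_tsupport h hs)

lemma continuous_partialDeriv_annulusBump (i : Fin 4) :
    Continuous (partialDeriv i annulusBump) :=
  ((contDiff_annulusBump (n := 1)).continuous_fderiv (by norm_num)).clm_apply continuous_const

lemma tsupport_partialDeriv_annulusBump (i : Fin 4) :
    tsupport (partialDeriv i annulusBump) ⊆ tsupport annulusBump := by
  refine (closure_mono ?_).trans (tsupport_fderiv_subset ℝ (f := annulusBump))
  intro y hy h
  refine hy ?_
  simp [partialDeriv, h]

/-- The gradient of the cutoff is radial. -/
lemma exists_partialDeriv_annulusBump (y : E4) :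
    ∃ c : ℝ, ∀ i, partialDeriv i annulusBump y = c * y i := by
  set χ : ContDiffBump (1 : ℝ) := ⟨1 / 4, 1 / 2, by norm_num, by norm_num⟩ with hχ
  have h1 : HasDerivAt χ (deriv χ (‖y‖ ^ 2)) (‖y‖ ^ 2) :=
    ((χ.contDiff (n := 1)).differentiable (by norm_num) _).hasDerivAt
  have h2 := h1.comp_hasFDerivAt y (hasStrictFDerivAt_norm_sq y).hasFDerivAt
  refine ⟨deriv χ (‖y‖ ^ 2) * 2, fun i => ?_⟩
  rw [partialDeriv, show annulusBump = χ ∘ fun y => ‖y‖ ^ 2 from rfl, h2.fderiv]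
  simp [EuclideanSpace.inner_single_right]
  ring

/-- Green's first identity on the annulus. The cutoff contributes nothing because its gradient is
radial and `v` is constant along rays. -/
lemma integral_bump_mul_laplacian {u v : E4 → ℝ} (hu : IsRayConstantC2 u)
    (hv : IsRayConstantC2 v) : ∫ y, annulusBump y * (u y * Δ v y) =
      -∫ y, annulusBump y * ∑ i, partialDeriv i u y * partialDeriv i v y := by
  have hb : Continuous annulusBump := (contDiff_annulusBump (n := 1)).continuous
  have hu' := fun i => (hu.contDiffOn_partialDeriv i).continuousOn
  have hv' := fun i => (hv.contDiffOn_partialDeriv i).continuousOn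
  have hv'' : ∀ i, ContinuousOn (partialDeriv i (partialDeriv i v)) {0}ᶜ := fun i =>
    ((hv.contDiffOn_partialDeriv i).continuousOn_fderiv_of_isOpen isOpen_compl_singleton
      (by norm_num)).clm_apply continuousOn_const
  have hdv : ∀ i, ∀ y ≠ 0, DifferentiableAt ℝ (partialDeriv i v) y := fun i y hy =>
    ((hv.contDiffOn_partialDeriv i).contDiffAt
      (isOpen_compl_singleton.mem_nhds hy)).differentiableAt (by norm_num)
  have hdb : ∀ y, DifferentiableAt ℝ annulusBump y :=
    (contDiff_annulusBump (n := 1)).differentiable (by norm_num)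
  -- the cut-off function is differentiable also at the origin, where it vanishes nearby
  have hdbu : ∀ y, DifferentiableAt ℝ (fun y => annulusBump y * u y) y := by
    intro y
    by_cases hy : y ∈ tsupport annulusBump
    · exact (hdb y).fun_mul (hu.differentiableAt (ne_zero_of_mem_tsupport hy))
    · have h1 : (fun y => annulusBump y * u y) =ᶠ[nhds y] fun _ => 0 := by
        filter_upwards [(notMem_tsupport_iff_eventuallyEq.1 hy)] with w hw
        simp [hw]
      exact (differentiableAt_const (0 : ℝ)).congr_of_eventuallyEq h1
  have hpd : ∀ i y, partialDeriv i (fun y => annulusBump y * u y) y * partialDeriv i v y =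
      annulusBump y * (partialDeriv i u y * partialDeriv i v y) +
        partialDeriv i annulusBump y * (u y * partialDeriv i v y) := by
    intro i y
    by_cases hy : y ∈ tsupport annulusBump
    · rw [partialDeriv_mul i (hdb y) (hu.differentiableAt (ne_zero_of_mem_tsupport hy))]
      ring
    · have h0 := notMem_tsupport_iff_eventuallyEq.1 hy
      have h1 : (fun y => annulusBump y * u y) =ᶠ[nhds y] fun _ => 0 := by
        filter_upwards [h0] with w hw
        simp [hw]
      rw [partialDeriv_congr i h1, partialDeriv_congr i h0, h0.self_of_nhds]
      simp [partialDeriv]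
  have i1 : ∀ i, Integrable fun y => annulusBump y * (partialDeriv i u y * partialDeriv i v y) :=
    fun i => integrable_mul_of_tsupport hb subset_rfl ((hu' i).fun_mul (hv' i))
  have i2 : ∀ i, Integrable fun y =>
      partialDeriv i annulusBump y * (u y * partialDeriv i v y) := fun i =>
    integrable_mul_of_tsupport (continuous_partialDeriv_annulusBump i)
      (tsupport_partialDeriv_annulusBump i) (hu.1.continuousOn.fun_mul (hv' i))
  have i3 : ∀ i, Integrable fun y =>
      annulusBump y * u y * partialDeriv i (partialDeriv i v) y := fun i => by
    simpa only [mul_assoc] using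
      integrable_mul_of_tsupport hb subset_rfl (hu.1.continuousOn.fun_mul (hv'' i))
  have hparts : ∀ i, ∫ y, annulusBump y * u y * partialDeriv i (partialDeriv i v) y =
      -∫ y, (annulusBump y * (partialDeriv i u y * partialDeriv i v y) +
        partialDeriv i annulusBump y * (u y * partialDeriv i v y)) := by
    intro i
    simp only [← hpd]
    refine integral_mul_fderiv_eq_neg_fderiv_mul_of_integrable
      (f := fun y => annulusBump y * u y) (g := partialDeriv i v)
      (v := EuclideanSpace.single i 1) ?_ (i3 i) ?_ (fun y _ => hdbu y) fun y hy => ?_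
    · refine ((i1 i).add (i2 i)).congr (Filter.Eventually.of_forall fun y => ?_)
      exact (hpd i y).symm
    · simpa only [mul_assoc] using
        integrable_mul_of_tsupport hb subset_rfl (hu.1.continuousOn.fun_mul (hv' i))
    · exact hdv i y (ne_zero_of_mem_tsupport (tsupport_mul_subset_left hy))
  have hL : ∀ y, annulusBump y * (u y * Δ v y) =
      ∑ i, annulusBump y * u y * partialDeriv i (partialDeriv i v) y := by
    intro y
    by_cases hy : y = 0
    · have h0 : annulusBump y = 0 := image_eq_zero_of_notMem_tsupport fun h =>
        ne_zero_of_mem_tsupport h hy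
      simp [h0]
    · rw [laplacian_eq_sum_partialDeriv (hv.contDiffAt hy), ← Finset.mul_sum, mul_assoc]
  have hR : ∀ y, ∑ i, (annulusBump y * (partialDeriv i u y * partialDeriv i v y) +
      partialDeriv i annulusBump y * (u y * partialDeriv i v y)) =
      annulusBump y * ∑ i, partialDeriv i u y * partialDeriv i v y := by
    intro y
    rw [Finset.sum_add_distrib, ← Finset.mul_sum, add_eq_left]
    by_cases hy : y = 0
    · refine Finset.sum_eq_zero fun i _ => ?_
      have h0 : partialDeriv i annulusBump y = 0 := image_eq_zero_of_notMem_tsupport fun h =>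
        ne_zero_of_mem_tsupport (tsupport_partialDeriv_annulusBump i h) hy
      rw [h0, zero_mul]
    · obtain ⟨c, hc⟩ := exists_partialDeriv_annulusBump y
      have h1 := hv.sum_coord_mul_partialDeriv hy
      have h2 : ∀ i, partialDeriv i annulusBump y * (u y * partialDeriv i v y) =
          (c * u y) * (y i * partialDeriv i v y) := fun i => by
        rw [hc]
        ring
      rw [Finset.sum_congr rfl fun i _ => h2 i, ← Finset.mul_sum, h1, mul_zero]
  simp only [hL, ← hR]
  rw [integral_finsetSum _ fun i _ => i3 i,
    integral_finsetSum _ fun i _ => (i1 i).fun_add (i2 i), ← Finset.sum_neg_distrib]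
  exact Finset.sum_congr rfl fun i _ => hparts i

/-- The inner product of functions on the sphere, computed on an annulus. -/
noncomputable def sphereInner (f g : S3 → ℝ) : ℝ :=
  ∫ y, annulusBump y * ((‖y‖ ^ 2)⁻¹ * (radialExtension f y * radialExtension g y))

/-- Eigenfunctions of the Laplace-Beltrami operator for different eigenvalues are orthogonal. -/
lemma sphereInner_eq_zero {f g : S3 → ℝ} {a b : ℝ} (hf : IsC2OnSphere f) (hg : IsC2OnSphere g)
    (hfa : ∀ x, laplaceBeltrami f x = a * f x) (hgb : ∀ x, laplaceBeltrami g x = b * g x)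
    (hab : a ≠ b) : sphereInner f g = 0 := by
  have hu := isRayConstantC2_radialExtension hf
  have hv := isRayConstantC2_radialExtension hg
  have key : ∀ (h : S3 → ℝ) (c : ℝ), IsC2OnSphere h → (∀ x, laplaceBeltrami h x = c * h x) →
      ∀ y : E4, y ≠ 0 →
        Δ (radialExtension h) y = c * ((‖y‖ ^ 2)⁻¹ * radialExtension h y) := by
    intro h c hh hc y hy
    have hy' : 0 < ‖y‖⁻¹ := inv_pos.2 (norm_pos_iff.2 hy)
    rw [(isRayConstantC2_radialExtension hh).laplacian_smul hy' y, radialExtension_of_ne h hy,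
      mul_left_comm, ← hc, laplaceBeltrami, inv_pow]
  have h1 := integral_bump_mul_laplacian hu hv
  have h2 := integral_bump_mul_laplacian hv hu
  have h3 : ∫ y, annulusBump y * (radialExtension f y * Δ (radialExtension g) y) =
      b * sphereInner f g := by
    rw [sphereInner, ← integral_const_mul]
    congr 1
    funext y
    by_cases hy : y = 0
    · have h0 : annulusBump y = 0 := image_eq_zero_of_notMem_tsupport fun h =>
        ne_zero_of_mem_tsupport h hy
      simp [h0]
    · rw [key g b hg hgb y hy]
      ring
  have h4 : ∫ y, annulusBump y * (radialExtension g y * Δ (radialExtension f) y) =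
      a * sphereInner f g := by
    rw [sphereInner, ← integral_const_mul]
    congr 1
    funext y
    by_cases hy : y = 0
    · have h0 : annulusBump y = 0 := image_eq_zero_of_notMem_tsupport fun h =>
        ne_zero_of_mem_tsupport h hy
      simp [h0]
    · rw [key f a hf hfa y hy]
      ring
  rw [h3] at h1
  rw [h4] at h2
  have h5 : ∀ y, ∑ i, partialDeriv i (radialExtension g) y * partialDeriv i (radialExtension f) y =
      ∑ i, partialDeriv i (radialExtension f) y * partialDeriv i (radialExtension g) y := fun y =>
    Finset.sum_congr rfl fun i _ => mul_comm _ _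
  simp only [h5] at h2
  have h6 : (a - b) * sphereInner f g = 0 := by rw [sub_mul, h1, h2, sub_self]
  exact (mul_eq_zero.1 h6).resolve_left (sub_ne_zero.2 hab)

end EllipsoidalS3

/-! ### Completeness of the spherical harmonics -/

namespace EllipsoidalS3

open MeasureTheory

lemma continuousOn_radialExtension {f : S3 → ℝ} (hf : Continuous f) :
    ContinuousOn (radialExtension f) {0}ᶜ := by
  rw [continuousOn_iff_continuous_domRestrict]
  have h : ({0}ᶜ : Set E4).domRestrict (radialExtension f) = fun y =>
      f ⟨‖y.1‖⁻¹ • y.1, by simp [norm_smul, norm_ne_zero_iff.mpr y.2]⟩ := by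
    funext y
    exact radialExtension_of_ne f y.2
  rw [h]
  refine hf.comp (Continuous.subtype_mk ?_ _)
  exact (continuous_subtype_val.norm.inv₀ fun y => norm_ne_zero_iff.2 y.2).smul
    continuous_subtype_val

lemma IsC2OnSphere.continuous {f : S3 → ℝ} (hf : IsC2OnSphere f) : Continuous f := by
  have h : Continuous fun x : S3 => radialExtension f x :=
    hf.continuousOn.comp_continuous continuous_subtype_val ne_zero_of_mem_S3
  simpa only [radialExtension_coe] using h

lemma continuousOn_inner_integrand {f g : S3 → ℝ} (hf : Continuous f) (hg : Continuous g) :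
    ContinuousOn (fun y : E4 => (‖y‖ ^ 2)⁻¹ * (radialExtension f y * radialExtension g y))
      {0}ᶜ := by
  have h1 : ContinuousOn (fun y : E4 => (‖y‖ ^ 2)⁻¹) {0}ᶜ :=
    ContinuousOn.inv₀ (by fun_prop) fun y hy => pow_ne_zero 2 (norm_ne_zero_iff.2 hy)
  exact h1.mul ((continuousOn_radialExtension hf).mul (continuousOn_radialExtension hg))

lemma continuous_annulusBump : Continuous annulusBump :=
  (contDiff_annulusBump (n := 0)).continuous

lemma integrable_inner_integrand {f g : S3 → ℝ} (hf : Continuous f) (hg : Continuous g) :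
    Integrable fun y => annulusBump y *
      ((‖y‖ ^ 2)⁻¹ * (radialExtension f y * radialExtension g y)) :=
  integrable_mul_of_tsupport continuous_annulusBump subset_rfl (continuousOn_inner_integrand hf hg)

lemma sphereInner_comm (f g : S3 → ℝ) : sphereInner f g = sphereInner g f := by
  simp only [sphereInner, mul_comm (radialExtension f _)]

lemma sphereInner_add_left {f f' g : S3 → ℝ} (hf : Continuous f) (hf' : Continuous f')
    (hg : Continuous g) : sphereInner (f + f') g = sphereInner f g + sphereInner f' g := by
  rw [sphereInner, sphereInner, sphereInner, ← integral_add (integrable_inner_integrand hf hg)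
    (integrable_inner_integrand hf' hg)]
  congr 1
  funext y
  rw [radialExtension_add]
  ring

lemma sphereInner_smul_left (c : ℝ) (f g : S3 → ℝ) :
    sphereInner (c • f) g = c * sphereInner f g := by
  rw [sphereInner, sphereInner, ← integral_const_mul]
  congr 1
  funext y
  rw [radialExtension_const_smul]
  ring

lemma sphereInner_add_right {f g g' : S3 → ℝ} (hf : Continuous f) (hg : Continuous g)
    (hg' : Continuous g') : sphereInner f (g + g') = sphereInner f g + sphereInner f g' := by
  rw [sphereInner_comm, sphereInner_add_left hg hg' hf, sphereInner_comm g, sphereInner_comm g']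

lemma sphereInner_smul_right (c : ℝ) (f g : S3 → ℝ) :
    sphereInner f (c • g) = c * sphereInner f g := by
  rw [sphereInner_comm, sphereInner_smul_left, sphereInner_comm]

lemma sphereInner_sub_left {f f' g : S3 → ℝ} (hf : Continuous f) (hf' : Continuous f')
    (hg : Continuous g) : sphereInner (f - f') g = sphereInner f g - sphereInner f' g := by
  rw [sub_eq_add_neg, ← neg_one_smul ℝ f', sphereInner_add_left hf (hf'.const_smul _) hg,
    sphereInner_smul_left]
  ring

lemma eq_zero_of_sphereInner_self_le {f : S3 → ℝ} (hf : Continuous f)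
    (h : sphereInner f f ≤ 0) : f = 0 := by
  by_contra hne
  obtain ⟨x, hx⟩ := Function.ne_iff.1 hne
  have hpos := Continuous.integral_pos_of_hasCompactSupport_nonneg_nonzero
    (μ := (volume : Measure E4)) (x := (x : E4))
    (continuous_mul_of_tsupport continuous_annulusBump subset_rfl
      (continuousOn_inner_integrand hf hf))
    (hasCompactSupport_mul_of_tsupport _ subset_rfl)
    (fun y => mul_nonneg (annulusBump_nonneg y)
      (mul_nonneg (by positivity) (mul_self_nonneg _))) ?_
  · exact absurd h (not_le.2 hpos)
  · have h1 := x.2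
    rw [mem_sphere_zero_iff_norm] at h1
    simpa [annulusBump_of_mem, radialExtension_coe, h1] using hx

lemma continuous_restrict (p : MvPolynomial (Fin 4) ℝ) : Continuous (restrictₗ p) :=
  (contDiff_polyFun p (n := 0)).continuous.comp continuous_subtype_val

/-- The coordinate functions on the sphere. -/
noncomputable def sphereCoord (i : Fin 4) : C(S3, ℝ) :=
  ⟨fun x => (x : E4) i, (contDiff_coord i (n := 0)).continuous.comp continuous_subtype_val⟩

lemma aeval_sphereCoord (p : MvPolynomial (Fin 4) ℝ) (x : S3) :
    MvPolynomial.aeval sphereCoord p x = restrictₗ p x := by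
  change _ = MvPolynomial.eval (fun i => (x : E4) i) p
  induction p using MvPolynomial.induction_on with
  | C a => simp
  | add p q hp hq => simp [hp, hq]
  | mul_X p i hp => simp [hp, sphereCoord]

/-- By the Stone-Weierstrass theorem, a continuous function orthogonal to the restrictions of all
polynomials vanishes. -/
lemma eq_zero_of_sphereInner_poly {f : S3 → ℝ} (hf : Continuous f)
    (h : ∀ p, sphereInner f (restrictₗ p) = 0) : f = 0 := by
  set A := (MvPolynomial.aeval (R := ℝ) sphereCoord).range with hA
  have hsep : A.SeparatesPoints := by
    intro x y hxy
    have h1 : (x : E4) ≠ y := fun h => hxy (Subtype.ext h)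
    obtain ⟨i, hi⟩ : ∃ i, (x : E4) i ≠ (y : E4) i := by
      by_contra! h2
      exact h1 (PiLp.ext h2)
    exact ⟨sphereCoord i, ⟨sphereCoord i, ⟨MvPolynomial.X i, MvPolynomial.aeval_X _ i⟩, rfl⟩, hi⟩
  set I : ℝ := ∫ y, annulusBump y * ((‖y‖ ^ 2)⁻¹ *
    (radialExtension (fun x => |f x|) y * radialExtension (fun _ => 1) y)) with hI
  have hint := integrable_inner_integrand hf.abs (continuous_const (y := (1 : ℝ)))
  have hI0 : 0 ≤ I := by
    refine integral_nonneg fun y => mul_nonneg (annulusBump_nonneg y)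
      (mul_nonneg (by positivity) (mul_nonneg ?_ ?_)) <;>
    · unfold radialExtension
      split_ifs <;> simp
  have hbound : ∀ ε > 0, sphereInner f f ≤ ε * I := by
    intro ε hε
    obtain ⟨⟨_, p, rfl⟩, hp⟩ :=
      ContinuousMap.exists_mem_subalgebra_near_continuous_of_separatesPoints A hsep f hf ε hε
    have hp' : ∀ x, |restrictₗ p x - f x| < ε := fun x => by
      rw [← aeval_sphereCoord]
      exact hp x
    have h1 : sphereInner f f = sphereInner (f - restrictₗ p) f := by
      rw [sphereInner_sub_left hf (continuous_restrict p) hf, sphereInner_comm (restrictₗ p), h,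
        sub_zero]
    rw [h1, sphereInner, hI, ← integral_const_mul]
    refine integral_mono (integrable_inner_integrand (hf.sub (continuous_restrict p)) hf)
      (hint.const_mul ε) fun y => ?_
    have h2 : radialExtension (f - restrictₗ p) y * radialExtension f y ≤
        ε * (radialExtension (fun x => |f x|) y * radialExtension (fun _ => 1) y) := by
      unfold radialExtension
      split_ifs with hy
      · simp
      · rw [mul_one]
        refine (le_abs_self _).trans ?_
        rw [abs_mul]
        refine mul_le_mul_of_nonneg_right ?_ (abs_nonneg _)
        rw [Pi.sub_apply, abs_sub_comm]
        exact (hp' _).le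
    have h3 : 0 ≤ annulusBump y * (‖y‖ ^ 2)⁻¹ := mul_nonneg (annulusBump_nonneg y) (by positivity)
    have h4 := mul_le_mul_of_nonneg_left h2 h3
    simp only
    linarith
  refine eq_zero_of_sphereInner_self_le hf (le_of_forall_pos_le_add fun δ hδ => ?_)
  have h1 := hbound (δ / (I + 1)) (by positivity)
  have h2 : δ / (I + 1) * I ≤ δ := by
    rw [div_mul_eq_mul_div, div_le_iff₀ (by positivity)]
    nlinarith
  linarith

instance (D : ℕ) : FiniteDimensional ℝ (sphericalHarmonics D) :=
  inferInstanceAs (FiniteDimensional ℝ ((harmonicPolys D).map restrictₗ))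

lemma continuous_of_mem_sphericalHarmonics {D : ℕ} {f : S3 → ℝ} (hf : f ∈ sphericalHarmonics D) :
    Continuous f := by
  obtain ⟨p, -, rfl⟩ := hf
  exact continuous_restrict p

/-- Orthogonal projection to the spherical harmonics of a given degree. -/
lemma exists_projection {f : S3 → ℝ} (hf : Continuous f) (D : ℕ) :
    ∃ q ∈ sphericalHarmonics D, ∀ g ∈ sphericalHarmonics D, sphereInner (f - q) g = 0 := by
  have hc := fun g : sphericalHarmonics D => continuous_of_mem_sphericalHarmonics g.2
  let B : sphericalHarmonics D →ₗ[ℝ] Module.Dual ℝ (sphericalHarmonics D) :=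
    LinearMap.mk₂ ℝ (fun g h => sphereInner g.1 h.1)
      (fun g g' h => sphereInner_add_left (hc g) (hc g') (hc h))
      (fun c g h => sphereInner_smul_left c g.1 h.1)
      (fun g h h' => sphereInner_add_right (hc g) (hc h) (hc h'))
      (fun c g h => sphereInner_smul_right c g.1 h.1)
  let ℓ : Module.Dual ℝ (sphericalHarmonics D) :=
    { toFun := fun h => sphereInner f h.1
      map_add' := fun h h' => sphereInner_add_right hf (hc h) (hc h')
      map_smul' := fun c h => sphereInner_smul_right c f h.1 }
  have hinj : Function.Injective B := by
    rw [← LinearMap.ker_eq_bot, LinearMap.ker_eq_bot']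
    intro g hg
    have h1 : sphereInner g.1 g.1 = 0 := LinearMap.congr_fun hg g
    exact Subtype.ext (eq_zero_of_sphereInner_self_le (hc g) h1.le)
  obtain ⟨q, hq⟩ := (LinearMap.injective_iff_surjective_of_finrank_eq_finrank
    (Subspace.dual_finrank_eq (K := ℝ) (V := sphericalHarmonics D)).symm).1 hinj ℓ
  refine ⟨q.1, q.2, fun g hg => ?_⟩
  have h1 : sphereInner q.1 g = sphereInner f g := LinearMap.congr_fun hq ⟨g, hg⟩
  rw [sphereInner_sub_left hf (hc q) (hc ⟨g, hg⟩), h1, sub_self]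

/-- Every twice continuously differentiable eigenfunction for the eigenvalue `-D (D + 2)` is the
restriction of a harmonic polynomial: its difference from its projection is orthogonal to all
spherical harmonics. -/
lemma mem_sphericalHarmonics_of_eigenfunction {f : S3 → ℝ} {D : ℕ} (hf : IsC2OnSphere f)
    (hfe : ∀ x, laplaceBeltrami f x = -(D * (D + 2)) * f x) : f ∈ sphericalHarmonics D := by
  obtain ⟨q, hq, hortho⟩ := exists_projection hf.continuous D
  have hqc := continuous_of_mem_sphericalHarmonics hq
  have hC2 : ∀ {k : ℕ} {g : S3 → ℝ}, g ∈ sphericalHarmonics k → IsC2OnSphere g ∧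
      ∀ x, laplaceBeltrami g x = -(k * (k + 2)) * g x := by
    rintro k _ ⟨p, hp, rfl⟩
    exact ⟨isC2OnSphere_restrict hp.1, laplaceBeltrami_restrict hp⟩
  have hall : ∀ k, ∀ g ∈ sphericalHarmonics k, sphereInner (f - q) g = 0 := by
    intro k g hg
    rcases eq_or_ne k D with rfl | hk
    · exact hortho g hg
    have hne : -((D : ℝ) * (D + 2)) ≠ -(k * (k + 2)) := by
      intro h
      have h1 : ((D : ℝ) - k) * (D + k + 2) = 0 := by linear_combination -h
      rcases mul_eq_zero.1 h1 with h2 | h2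
      · exact hk (by exact_mod_cast (sub_eq_zero.1 h2).symm)
      · have : (0 : ℝ) < D + k + 2 := by positivity
        linarith
    rw [sphereInner_sub_left hf.continuous hqc (continuous_of_mem_sphericalHarmonics hg),
      sphereInner_eq_zero hf (hC2 hg).1 hfe (hC2 hg).2 hne,
      sphereInner_eq_zero (hC2 hq).1 (hC2 hg).1 (hC2 hq).2 (hC2 hg).2 hne, sub_zero]
  have hfq : Continuous (f - q) := hf.continuous.sub hqc
  have hsup : ∀ g ∈ ⨆ k, sphericalHarmonics k, Continuous g ∧ sphereInner (f - q) g = 0 := by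
    intro g hg
    induction hg using Submodule.iSup_induction' with
    | mem k g hg => exact ⟨continuous_of_mem_sphericalHarmonics hg, hall k g hg⟩
    | zero => exact ⟨continuous_const, hall D 0 (Submodule.zero_mem _)⟩
    | add g g' _ _ h h' =>
      exact ⟨h.1.add h'.1, by rw [sphereInner_add_right hfq h.1 h'.1, h.2, h'.2, add_zero]⟩
  have h0 := eq_zero_of_sphereInner_poly hfq fun p =>
    (hsup _ (restrict_mem_iSup_sphericalHarmonics p)).2
  rwa [sub_eq_zero.1 h0]

/-- The solutions of the Schrödinger equation on the sphere are the spherical harmonics. -/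
lemma isSchrodingerSolution_iff {hbar : ℝ} (hhbar : 0 < hbar) {D : ℕ} {ψ : S3 → ℝ} :
    IsSchrodingerSolution hbar (hbar ^ 2 * (D * (D + 2))) ψ ↔ ψ ∈ sphericalHarmonics D := by
  constructor
  · rintro ⟨hC2, heq⟩
    refine mem_sphericalHarmonics_of_eigenfunction hC2 fun x => ?_
    have hb : hbar ^ 2 ≠ 0 := by positivity
    apply mul_left_cancel₀ hb
    linear_combination -heq x
  · rintro ⟨p, hp, rfl⟩
    exact isSchrodingerSolution_restrict hbar hp

end EllipsoidalS3

theorem mainTheorem2 (e : Fin 4 → ℝ) (he : StrictMono e) (D : ℕ) (hbar : ℝ) (hhbar : 0 < hbar) :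
    -- exactly eight symmetry classes have the parity of the energy, the others carry no state
    (EllipsoidalS3.admissibleClasses D).card = 8 ∧
    (∀ μ, μ ∉ EllipsoidalS3.admissibleClasses D → EllipsoidalS3.classStates e D μ = ∅) ∧
    -- the number of Heine-Stieltjes polynomials of degree `d`, and the location of their zeros
    (∀ (μ : EllipsoidalS3.SymClass) (d : ℕ),
      (EllipsoidalS3.heineStieltjes e (EllipsoidalS3.gammaParam μ) d).Finite ∧
      (EllipsoidalS3.heineStieltjes e (EllipsoidalS3.gammaParam μ) d).ncard
        = Nat.choose (d + 2) 2 ∧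
      ∀ S ∈ EllipsoidalS3.heineStieltjes e (EllipsoidalS3.gammaParam μ) d,
        S.roots.card = d ∧ S.roots.Nodup ∧
        ∀ z ∈ S.roots, ∃ j : Fin 3, z ∈ Set.Ioo (e j.castSucc) (e j.succ)) ∧
    -- the number of states in each symmetry class
    (∀ μ ∈ EllipsoidalS3.admissibleClasses D,
      (EllipsoidalS3.classStates e D μ).Finite ∧
      (EllipsoidalS3.classStates e D μ).ncard = Nat.choose ((D + 4 - μ.weight) / 2) 2) ∧
    -- the total number of states
    (∑ μ ∈ EllipsoidalS3.admissibleClasses D, (EllipsoidalS3.classStates e D μ).ncard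
      = (D + 1) ^ 2) ∧
    (EllipsoidalS3.eigenstates e D).Finite ∧
    (EllipsoidalS3.eigenstates e D).ncard = (D + 1) ^ 2 ∧
    -- each state is a separated solution of the Schrödinger equation and a harmonic polynomial
    (∀ st ∈ EllipsoidalS3.eigenstates e D,
      EllipsoidalS3.waveFunction e st.1 st.2 ∈ EllipsoidalS3.harmonicPolys D ∧
      EllipsoidalS3.HasSymmetry st.1 (EllipsoidalS3.waveFunction e st.1 st.2) ∧
      EllipsoidalS3.IsSchrodingerSolution hbar (hbar ^ 2 * (D * (D + 2)))
        (EllipsoidalS3.restrictToSphere (EllipsoidalS3.waveFunction e st.1 st.2)) ∧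
      ∀ (x : Fin 4 → ℝ) (s : Fin 3 → ℝ), EllipsoidalS3.IsEllipsoidalCoord e x s →
        MvPolynomial.eval x (EllipsoidalS3.waveFunction e st.1 st.2)
          = (-1) ^ st.2.natDegree * (∏ i, x i ^ (st.1 i : ℕ)) * ∏ j, st.2.eval (s j)) ∧
    -- the states form a basis of the harmonic polynomials of degree `D`
    LinearIndependent ℝ (fun st : EllipsoidalS3.eigenstates e D =>
      EllipsoidalS3.waveFunction e st.1.1 st.1.2) ∧
    Submodule.span ℝ (Set.range fun st : EllipsoidalS3.eigenstates e D =>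
      EllipsoidalS3.waveFunction e st.1.1 st.1.2) = EllipsoidalS3.harmonicPolys D ∧
    Module.finrank ℝ (EllipsoidalS3.harmonicPolys D) = (D + 1) ^ 2 ∧
    -- their restrictions form a basis of the solutions of the Schrödinger equation on the sphere
    LinearIndependent ℝ (fun st : EllipsoidalS3.eigenstates e D =>
      EllipsoidalS3.restrictToSphere (EllipsoidalS3.waveFunction e st.1.1 st.1.2)) ∧
    (∀ ψ : EllipsoidalS3.S3 → ℝ,
      EllipsoidalS3.IsSchrodingerSolution hbar (hbar ^ 2 * (D * (D + 2))) ψ ↔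
        ψ ∈ Submodule.span ℝ (Set.range fun st : EllipsoidalS3.eigenstates e D =>
          EllipsoidalS3.restrictToSphere
            (EllipsoidalS3.waveFunction e st.1.1 st.1.2))) := by
  refine ⟨EllipsoidalS3.card_admissibleClasses D,
    fun μ hμ => EllipsoidalS3.classStates_of_not_admissible e hμ, fun μ d => ?_, fun μ hμ =>
    ⟨EllipsoidalS3.classStates_finite he D μ, EllipsoidalS3.classStates_ncard he hμ⟩,
    EllipsoidalS3.sum_classStates_ncard he D, EllipsoidalS3.eigenstates_finite he D,
    EllipsoidalS3.eigenstates_ncard he D, fun st hst => ?_,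
    EllipsoidalS3.waveFunction_linearIndependent he D, (EllipsoidalS3.span_waveFunction he D).1,
    (EllipsoidalS3.span_waveFunction he D).2,
    EllipsoidalS3.restrict_waveFunction_linearIndependent he D, fun ψ => ?_⟩
  · obtain ⟨hfin, hcard, hroots⟩ :=
      EllipsoidalS3.heineStieltjes_count he (EllipsoidalS3.gammaParam_pos μ) d
    refine ⟨hfin, hcard, fun S hS => ?_⟩
    obtain ⟨Z, rfl, hZ, hgap⟩ := hroots S hS
    rw [EllipsoidalS3.roots_rootPoly]
    exact ⟨hZ, Z.nodup, hgap⟩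
  · have hharm := EllipsoidalS3.waveFunction_mem_harmonicPolys he hst
    refine ⟨hharm, EllipsoidalS3.hasSymmetry_waveFunction e st.1 st.2,
      EllipsoidalS3.isSchrodingerSolution_restrict hbar hharm, fun x s hxs => ?_⟩
    obtain ⟨Z, hZ, -⟩ := EllipsoidalS3.exists_rootPoly_of_mem_eigenstates he hst
    rw [hZ, EllipsoidalS3.natDegree_rootPoly]
    exact EllipsoidalS3.eval_waveFunction_ellipsoidal he st.1 Z hxs.2
  · have hrange : Set.range (fun st : EllipsoidalS3.eigenstates e D =>
        EllipsoidalS3.restrictToSphere (EllipsoidalS3.waveFunction e st.1.1 st.1.2)) =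
        EllipsoidalS3.restrictₗ '' Set.range fun st : EllipsoidalS3.eigenstates e D =>
          EllipsoidalS3.waveFunction e st.1.1 st.1.2 := by
      rw [← Set.range_comp]
      rfl
    rw [hrange, Submodule.span_image, (EllipsoidalS3.span_waveFunction he D).1]
    exact EllipsoidalS3.isSchrodingerSolution_iff hhbar
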